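/- Let $N=2^n$ with $n\ge 0$, $\log=\log_2$, $\omega_N=e^{-2\pi i/N}$, and let $F_N=(\omega_N^{jk})_{0\le j,k<N}$ be the DFT matrix. A vector $x\in\mathbb C^N$ is given by the $2N$ real and imaginary parts of its entries. An algorithm performs real additions and subtractions, multiplications by fixed real constants, divisions by $2$, and multiplications by $2^e$ ($e\in\mathbb N$), each counted as one real operation, except that multiplying by $0,1,-1$ (in particular by $2^0$) is free, and in an expression $ru+r'v$ with constants $r,r'$ no addition is counted if $r=0$ or $r'=0$. Indices of a vector are taken modulo its length. *Walsh–Hadamard procedure* $H(x,k)$ for $x\in\mathbb C^M$, $M=2^m$. If $M\le 4$, multiply all entries by $2^k$ and apply the folklore fast transform ($u,v\mapsto (u+v,u-v)$ on the recursively transformed halves). If $M\ge 8$, split $x$ into eight consecutive blocks of length $M/8$, let $a$ be the result of $H(\cdot,k)$ on the first block and $b,c,d,e,f,g,h$ the results of $H(\cdot,k+1)$ on the others, and compute entrywise $B_1=b+c$, $B_2=d+h$, $B_3=f+g$, $t=(B_1+B_2+B_3+e)/2$, $q=a-t$, $D=q+d$, $E=q+e$, $G=q+h$; the eight output blocks are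 $a+t,\ E+c+g,\ E+b+f,\ E+B_2,\ D+B_1,\ G+c+f,\ G+b+g,\ D+B_3$. *Procedure* $H'$. Let $P(1)=[[0]]$, $P(2)=[[0],[1]]$, and for $N\ge4$ let $P(N)$ consist of the arrays of $P(N/2)$ followed by the arrays of $P(N/4)$ in which each index $i$ is replaced by the two entries $i+N/2,\ i+3N/4$. Let $\pi_N$ be the split-radix order: $\pi_1,\pi_2$ are the identity, and for $N\ge 4$, $\pi_N(i)=2\pi_{N/2}(i)$ for $i<N/2$, $\pi_N(N/2+i)=4\pi_{N/4}(i)+1$ and $\pi_N(3N/4+i)=4\pi_{N/4}(i)-1 \bmod N$ for $i<N/4$. For every array $(i_0,\dots,i_{M-1})$ in $P(N)$, $H'$ replaces the entries of $x$ at positions $\pi_N(i_0),\dots,\pi_N(i_{M-1})$ by $H\big((x_{\pi_N(i_0)},\dots,x_{\pi_N(i_{M-1})}),0\big)$. *Twiddle procedures.* Let $s_{N,k}=1$ for $N\le4$ and otherwise, with $\kappa=k\bmod N/4$, let $s_{N,k}=s_{N/4,\kappa}\cos(2\pi\kappa/N)$ if $\kappa\le N/8$ and $s_{N,k}=s_{N/4,\kappa}\sin(2\pi\kappa/N)$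 if $\kappa>N/8$. The procedures $TW,TWS,TWS2,TWS4$ are the identity for $N=1$ and the length-2 DFT for $N=2$, where in $TWS4$ the second output is multiplied by $1/s_{8,1}$. For $N\ge4$, $TW$, $TWS$, $TWS2$, $TWS4$ compute $A$ by calling $TW$, $TWS2$, $TWS4$, $TWS2$, respectively, on $(x_{2j})_{j<N/2}$, and $B,C$ by calling $TWS$ on $(x_{4j+1})_{j<N/4}$ and $(x_{4j-1})_{j<N/4}$. Then for $0\le k<N/4$, with $A_k=a+a'i$, $A_{k+N/4}=z+z'i$, $B_k=b+b'i$, $C_k=c+c'i$, and $r+r'i=\omega_N^k s_{N/4,k}$ in $TW$, $r+r'i=\omega_N^k s_{N/4,k}/s_{N,k}$ in the others, they compute $D=rb+r'(-c')$, $E=rb'+r'c$, $F=r'b+rc'$, $G=r'b'+r(-c)$; in $TWS2$ they then multiply $D,E$ by $s_{N,k}/s_{2N,k}$ and $F,G$ by $s_{N,k}/s_{2N,k+N/4}$; the outputs are $y_k=(a+D)+(a'+E)i$, $y_{k+N/4}=(z+F)+(z'+G)i$, $y_{k+N/2}=(a-D)+(a'-E)i$, $y_{k+3N/4}=(z-F)+(z'-G)i$,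 where in $TWS4$ each $y_{k+jN/4}$ is finally multiplied by $s_{N,k}/s_{4N,k+jN/4}$ ($j=0,1,2,3$). **Theorem.** For every $N$ a power of $2$ and every $x\in\mathbb C^N$, the Walsh–Hadamard Uprooted FFT, $x\mapsto TW(H'(x))$, outputs $F_Nx$. It uses at most $\frac{15}{4}N\log N-\frac{223}{108}N+o(N^{0.8})$ real operations, and their number is $\frac{15}{4}N\log N+O(N)$. They consist of $\frac{67}{18}N\log N+O(N)$ real additions, subtractions and multiplications, at most $\frac1{36}N\log N$ divide-by-2 operations, and at most $2N-2$ multiply-by-a-power-of-2 operations. -/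

import Mathlib

open Asymptotics Filter Matrix

noncomputable section

namespace Whufft

/-! ### Programs with counted real operations -/

/-- Straight-line arithmetic programs over a type `V` of real registers, returning a value in `α`.
An algorithm below is a family `(V : Type) → … → Comp V α`; being polymorphic in `V`, it can touch
the data only through the instructions listed here. -/
inductive Comp (V α : Type) : Type
  /-- return a result -/
  | ret (a : α)
  /-- `x + y` -/
  | add (x y : V) (next : V → Comp V α)
  /-- `x - y` -/
  | sub (x y : V) (next : V → Comp V α)
  /-- `c * x` for a fixed (precomputed) real constant `c` -/
  | smul (c : ℝ) (x : V) (next : V → Comp V α)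
  /-- `x / 2` -/
  | half (x : V) (next : V → Comp V α)
  /-- `2 ^ e * x` -/
  | shift (e : ℕ) (x : V) (next : V → Comp V α)

namespace Comp

variable {V α β : Type}

/-- Sequential composition. -/
def bind : Comp V α → (α → Comp V β) → Comp V β
  | ret a, f => f a
  | add x y next, f => add x y fun v => (next v).bind f
  | sub x y next, f => sub x y fun v => (next v).bind f
  | smul c x next, f => smul c x fun v => (next v).bind f
  | half x next, f => half x fun v => (next v).bind f
  | shift e x next, f => shift e x fun v => (next v).bind f

instance : Monad (Comp V) where
  pure := ret
  bind := bind

/-- The result of running a program on real registers. -/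
def eval : Comp ℝ α → α
  | ret a => a
  | add x y next => (next (x + y)).eval
  | sub x y next => (next (x - y)).eval
  | smul c x next => (next (c * x)).eval
  | half x next => (next (x / 2)).eval
  | shift e x next => (next (2 ^ e * x)).eval

/-- Number of real additions and subtractions performed by a run. -/
def adds : Comp ℝ α → ℕ
  | ret _ => 0
  | add x y next => (next (x + y)).adds + 1
  | sub x y next => (next (x - y)).adds + 1
  | smul c x next => (next (c * x)).adds
  | half x next => (next (x / 2)).adds
  | shift e x next => (next (2 ^ e * x)).adds

open Classical in
/-- Number of real multiplications (by constants) performed by a run; multiplying by `0`, `1` or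
`-1` is free. -/
def muls : Comp ℝ α → ℕ
  | ret _ => 0
  | add x y next => (next (x + y)).muls
  | sub x y next => (next (x - y)).muls
  | smul c x next => (next (c * x)).muls + if c = 0 ∨ c = 1 ∨ c = -1 then 0 else 1
  | half x next => (next (x / 2)).muls
  | shift e x next => (next (2 ^ e * x)).muls

/-- Number of divide-by-two operations performed by a run. -/
def halves : Comp ℝ α → ℕ
  | ret _ => 0
  | add x y next => (next (x + y)).halves
  | sub x y next => (next (x - y)).halves
  | smul c x next => (next (c * x)).halves
  | half x next => (next (x / 2)).halves + 1
  | shift e x next => (next (2 ^ e * x)).halves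

/-- Number of multiply-by-a-power-of-two operations performed by a run; multiplying by `2 ^ 0` is
free. -/
def shifts : Comp ℝ α → ℕ
  | ret _ => 0
  | add x y next => (next (x + y)).shifts
  | sub x y next => (next (x - y)).shifts
  | smul c x next => (next (c * x)).shifts
  | half x next => (next (x / 2)).shifts
  | shift e x next => (next (2 ^ e * x)).shifts + if e = 0 then 0 else 1

/-- Total number of real operations performed by a run. -/
def total (p : Comp ℝ α) : ℕ := p.adds + p.muls + p.halves + p.shifts

/-- Run a loop body for all indices below `m`, in order, and collect the results. -/
def forEach : (m : ℕ) → (Fin m → Comp V α) → Comp V (Fin m → α)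
  | 0, _ => pure Fin.elim0
  | m + 1, f => do
    let a ← f 0
    let as ← forEach m fun i => f i.succ
    pure (Fin.cons a as)

end Comp

/-! ### Single instructions, and complex numbers as pairs of real registers -/

section Instructions

variable {V : Type}

def rAdd (x y : V) : Comp V V := .add x y .ret
def rSub (x y : V) : Comp V V := .sub x y .ret
def rSmul (c : ℝ) (x : V) : Comp V V := .smul c x .ret

open Classical in
/-- `r * u + q * v` for fixed real constants `r`, `q`. When one of the two constants is zero, the
corresponding term is absent and no addition takes place. -/
def rLin (r : ℝ) (u : V) (q : ℝ) (v : V) : Comp V V :=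
  if r = 0 then rSmul q v
  else if q = 0 then rSmul r u
  else do
    let u' ← rSmul r u
    let v' ← rSmul q v
    rAdd u' v'

def cAdd (x y : V × V) : Comp V (V × V) := do
  let a ← rAdd x.1 y.1
  let b ← rAdd x.2 y.2
  pure (a, b)

def cSub (x y : V × V) : Comp V (V × V) := do
  let a ← rSub x.1 y.1
  let b ← rSub x.2 y.2
  pure (a, b)

/-- Multiplication of a complex number by a fixed real constant. -/
def cSmul (c : ℝ) (x : V × V) : Comp V (V × V) := do
  let a ← rSmul c x.1
  let b ← rSmul c x.2
  pure (a, b)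

def cHalf (x : V × V) : Comp V (V × V) :=
  .half x.1 fun a => .half x.2 fun b => .ret (a, b)

def cShift (e : ℕ) (x : V × V) : Comp V (V × V) :=
  .shift e x.1 fun a => .shift e x.2 fun b => .ret (a, b)

end Instructions

/-- Vectors of `N = 2 ^ n` complex numbers, each stored as its real and its imaginary part. -/
abbrev CVec (V : Type) (n : ℕ) : Type := Fin (2 ^ n) → V × V

section Vectors

variable {V : Type} {n : ℕ}

/-- The entry `x[i]`, with the index taken modulo the length of `x`. -/
def CVec.get (x : CVec V n) (i : ℕ) : V × V := x (Fin.ofNat (2 ^ n) i)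

/-- The assignments `y[idx j] ← out j` for `j = 0, …, m - 1`. -/
def CVec.write (y : CVec V n) {m : ℕ} (idx : Fin m → ℕ) (out : Fin m → V × V) : CVec V n :=
  (List.finRange m).foldl (fun y j => Function.update y (Fin.ofNat (2 ^ n) (idx j)) (out j)) y

end Vectors

/-! ### The Walsh-Hadamard transform from the non-rigidity of `H₈` -/

section WalshHadamard

variable {V : Type}

/-- The folklore fast Walsh-Hadamard transform. -/
def folkloreWHT : (m : ℕ) → CVec V m → Comp V (CVec V m)
  | 0, x => pure x
  | m + 1, x => do
    let u ← folkloreWHT m fun i => CVec.get x i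
    let v ← folkloreWHT m fun i => CVec.get x (2 ^ m + i)
    let out ← Comp.forEach (2 ^ m) fun i => do
      let p ← cAdd (u i) (v i)
      let q ← cSub (u i) (v i)
      pure ![p, q]
    pure fun i => out (Fin.ofNat (2 ^ m) i) (Fin.ofNat 2 (i / 2 ^ m))

/-- Scale the inputs by `2 ^ k`, then use the folklore transform. -/
def baseWHT (m k : ℕ) (x : CVec V m) : Comp V (CVec V m) := do
  let x' ← Comp.forEach (2 ^ m) fun i => cShift k (x i)
  folkloreWHT m x'

/-- One entry of the combination step for blocks `a, b, …, h`, of which all but `a` come scaled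
by `2`; the eight results are the entries of the eight output blocks. -/
def combine8 (w : Fin 8 → V × V) : Comp V (Fin 8 → V × V) := do
  let a := w 0
  let b := w 1
  let c := w 2
  let d := w 3
  let e := w 4
  let f := w 5
  let g := w 6
  let h := w 7
  let B1 ← cAdd b c
  let B2 ← cAdd d h
  let B3 ← cAdd f g
  let t1 ← cAdd B1 B2
  let t2 ← cAdd t1 B3
  let t3 ← cAdd t2 e
  let tot ← cHalf t3
  let diff ← cSub a tot
  let D ← cAdd diff d
  let E ← cAdd diff e
  let H ← cAdd diff h
  let y0 ← cAdd a tot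
  let Ec ← cAdd E c
  let y1 ← cAdd Ec g
  let Eb ← cAdd E b
  let y2 ← cAdd Eb f
  let y3 ← cAdd E B2
  let y4 ← cAdd D B1
  let Hc ← cAdd H c
  let y5 ← cAdd Hc f
  let Hb ← cAdd H b
  let y6 ← cAdd Hb g
  let y7 ← cAdd D B3
  pure ![y0, y1, y2, y3, y4, y5, y6, y7]

/-- The procedure `H₈(x, k)`, which returns `2 ^ k` times the Walsh-Hadamard transform of `x`. -/
def wht : (m k : ℕ) → CVec V m → Comp V (CVec V m)
  | 0, k, x => baseWHT 0 k x
  | 1, k, x => baseWHT 1 k x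
  | 2, k, x => baseWHT 2 k x
  | m + 3, k, x => do
    let w ← Comp.forEach 8 fun b =>
      wht m (if b = 0 then k else k + 1) fun i => CVec.get x (b * 2 ^ m + i)
    let out ← Comp.forEach (2 ^ m) fun i => combine8 fun b => w b i
    pure fun i => out (Fin.ofNat (2 ^ m) i) (Fin.ofNat 8 (i / 2 ^ m))

end WalshHadamard

/-! ### The transform `H'` -/

/-- `Partition(2 ^ n)`: a list of index arrays, each of length a power `2 ^ m` of two. The arrays
of `Partition(N/4)` are copied with every index replaced by the two consecutive entries
`index + N/2` and `index + 3N/4`. -/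
def partition : ℕ → List (Σ m : ℕ, Fin (2 ^ m) → ℕ)
  | 0 => [⟨0, fun _ => 0⟩]
  | 1 => [⟨0, fun _ => 0⟩, ⟨0, fun _ => 1⟩]
  | n + 2 =>
    partition (n + 1) ++ (partition n).map fun s =>
      ⟨s.1 + 1, fun j =>
        s.2 (Fin.ofNat (2 ^ s.1) (j / 2)) + if (j : ℕ) % 2 = 0 then 2 * 2 ^ n else 3 * 2 ^ n⟩

/-- The split-radix order of the indices of a vector of length `N = 2 ^ n`: recursively the even
positions `2j`, then the positions `4j + 1`, then the positions `4j - 1` (modulo `N`). The `i`-th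
index in this order is `splitRadixIndex n i`. -/
def splitRadixIndex : ℕ → ℕ → ℕ
  | 0, i => i
  | 1, i => i
  | n + 2, i =>
    if i < 2 * 2 ^ n then 2 * splitRadixIndex (n + 1) i
    else if i < 3 * 2 ^ n then 4 * splitRadixIndex n (i - 2 * 2 ^ n) + 1
    else (4 * splitRadixIndex n (i - 3 * 2 ^ n) + (4 * 2 ^ n - 1)) % (4 * 2 ^ n)

/-- The procedure `H'`: a Walsh-Hadamard transform on each array of the partition, where the vector
is accessed in split-radix order. -/
def hPrime {V : Type} (n : ℕ) (x : CVec V n) : Comp V (CVec V n) :=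
  (partition n).foldlM
    (fun y s => do
      let idx := fun j => splitRadixIndex n (s.2 j)
      let out ← wht s.1 0 fun j => CVec.get x (idx j)
      pure (CVec.write y idx out))
    x

/-! ### The twiddle procedures -/

/-- The root of unity `ω_N = exp (-2πi / N)`. -/
def omega (N : ℕ) : ℂ := Complex.exp (-2 * Real.pi * Complex.I / N)

/-- The scale factors `s_{N, k}`, with `N = 2 ^ e`. -/
def scale : ℕ → ℕ → ℝ
  | 0, _ => 1
  | 1, _ => 1
  | 2, _ => 1
  | e + 3, k =>
    let k4 := k % 2 ^ (e + 1)
    let θ : ℝ := 2 * Real.pi * k4 / 2 ^ (e + 3)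
    if k4 ≤ 2 ^ e then scale (e + 1) k4 * Real.cos θ else scale (e + 1) k4 * Real.sin θ

/-- The four procedures `TW`, `TWS`, `TWS2`, `TWS4`. -/
inductive Proc
  | TW
  | TWS
  | TWS2
  | TWS4

/-- The procedure called on the even-indexed half of the input. -/
def Proc.even : Proc → Proc
  | .TW => .TW
  | .TWS => .TWS2
  | .TWS2 => .TWS4
  | .TWS4 => .TWS2

/-- The twiddle factor used for inputs of length `N = 2 ^ (n + 2)`: it is `ω_N ^ k * s_{N/4, k}` in
`TW`, and `t_N ^ k = ω_N ^ k * (s_{N/4, k} / s_{N, k})` in the other procedures. -/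
def Proc.twiddle (n k : ℕ) : Proc → ℂ
  | .TW => omega (2 ^ (n + 2)) ^ k * (scale n k : ℝ)
  | _ => omega (2 ^ (n + 2)) ^ k * (scale n k / scale (n + 2) k : ℝ)

section Twiddle

variable {V : Type}

/-- The multiplication of `D, E` or `F, G` by `c`, which takes place in `TWS2` only. -/
def Proc.scaleMid (c : ℝ) (x : V × V) : Proc → Comp V (V × V)
  | .TWS2 => cSmul c x
  | _ => pure x

/-- The multiplication of an output entry by `c`, which takes place in `TWS4` only. -/
def Proc.scaleEnd (c : ℝ) (x : V × V) : Proc → Comp V (V × V)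
  | .TWS4 => cSmul c x
  | _ => pure x

/-- Iteration `k` of the loop, for inputs of length `N = 2 ^ (n + 2)`: from `A_k`, `A_{k + N/4}`,
`B_k`, `C_k` compute `y_k`, `y_{k + N/4}`, `y_{k + N/2}`, `y_{k + 3N/4}`. -/
def loopBody (p : Proc) (n k : ℕ) (a z b c : V × V) : Comp V (Fin 4 → V × V) := do
  let r := (p.twiddle n k).re
  let r' := (p.twiddle n k).im
  let c1neg ← rSmul (-1) c.1
  let c2neg ← rSmul (-1) c.2
  let D ← rLin r b.1 r' c2neg
  let E ← rLin r b.2 r' c.1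
  let F ← rLin r' b.1 r c.2
  let G ← rLin r' b.2 r c1neg
  let s := scale (n + 2) k
  let DE ← p.scaleMid (s / scale (n + 3) k) (D, E)
  let FG ← p.scaleMid (s / scale (n + 3) (k + 2 ^ n)) (F, G)
  let y0 ← cAdd a DE
  let y1 ← cAdd z FG
  let y2 ← cSub a DE
  let y3 ← cSub z FG
  Comp.forEach 4 fun j =>
    p.scaleEnd (s / scale (n + 4) (k + j * 2 ^ n)) (![y0, y1, y2, y3] j)

/-- The procedures `TW`, `TWS`, `TWS2`, `TWS4`. The base cases are the identity and the transform
of length 2; the latter has its output rescaled by `1 / s_{8, k}` in `TWS4` (for `k = 0`, and for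
length 2 in the other procedures, the scale factor is `1`). -/
def tw : (n : ℕ) → Proc → CVec V n → Comp V (CVec V n)
  | 0, _, x => pure x
  | 1, p, x => do
    let y0 ← cAdd (x 0) (x 1)
    let y1 ← cSub (x 0) (x 1)
    let y1' ← p.scaleEnd (1 / scale 3 1) y1
    pure ![y0, y1']
  | n + 2, p, x => do
    let A ← tw (n + 1) p.even fun j => CVec.get x (2 * j)
    let B ← tw n .TWS fun j => CVec.get x (4 * j + 1)
    let C ← tw n .TWS fun j => CVec.get x (4 * j + (2 ^ (n + 2) - 1))
    let out ← Comp.forEach (2 ^ n) fun k =>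
      loopBody p n k (CVec.get A k) (CVec.get A (k + 2 ^ n)) (B k) (C k)
    pure fun i => out (Fin.ofNat (2 ^ n) i) (Fin.ofNat 4 (i / 2 ^ n))

end Twiddle

/-- The Walsh-Hadamard Uprooted FFT, `TW(H'(x))`, on `2 * 2 ^ n` real registers. -/
def whufft (V : Type) (n : ℕ) (x : CVec V n) : Comp V (CVec V n) := do
  let h ← hPrime n x
  tw n .TW h

/-! ### Running the algorithm on complex vectors, and the discrete Fourier transform -/

/-- The run of the algorithm on the real and imaginary parts of the entries of `x`. -/
def whufftRun (n : ℕ) (x : Fin (2 ^ n) → ℂ) : Comp ℝ (CVec ℝ n) :=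
  whufft ℝ n fun j => ((x j).re, (x j).im)

/-- The complex vector output by the run on `x`. -/
def whufftOutput (n : ℕ) (x : Fin (2 ^ n) → ℂ) : Fin (2 ^ n) → ℂ := fun k =>
  ⟨((whufftRun n x).eval k).1, ((whufftRun n x).eval k).2⟩

/-- The DFT matrix `F_N`, with entries `ω_N ^ (j * k)`. -/
def dftMatrix (N : ℕ) : Matrix (Fin N) (Fin N) ℂ :=
  Matrix.of fun j k => omega N ^ ((j : ℕ) * (k : ℕ))

end Whufft

end

noncomputable section

namespace Whufft

/-! ### Semantics and costs of programs -/

namespace Comp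

variable {α β : Type}

/-! Correctness. The split-radix identity `dft_splitRadix` writes a DFT as the DFT of the even
entries plus `ω^k Z + ω^{-k} Z'`, where `Z` and `Z'` are the transforms of the entries at `4t+1` and
`4t-1`. Since `ω^k Z + ω^{-k} Z' = cos θ (Z + Z') - i sin θ (Z - Z')`, a butterfly can start from `Z
+ Z'` and `Z - Z'`. By linearity these are the transforms of the sum and difference sequences, so
the additions can be pulled back to the input at every level. Collected there, they form
Walsh-Hadamard transforms on the arrays of the partition. The invariant is `IsUprooted`. It passes
to the even half and, with `f` replaced by the sum or difference sequence, to the two odd quarters.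
`toC_tw` is an induction over all `f` at once, carrying the denominators `Proc.denom` along. Cost of
the twiddle part. Each scale factor is an earlier one times `max |cos| |sin|` (`scale_add_two`), so
outside `TW` one component of every twiddle factor is `±1` and its multiplication is free. The
counts are exact because no other constant is accidentally free. The delicate case is the ratio in
`TWS2`, settled by degrees of cyclotomic fields in `scale_ne_scale_succ`. The resulting linear
recurrences have closed forms with leading term `28/9 N log N`. Cost of `H'`. An order-8 step on
eight complex entries takes 44 real additions and 2 halvings instead of 48 additions. An array of
length `M` therefore costs `2M log M - M⌊log M / 3⌋/2` additions and `M⌊log M / 3⌋/4` halvings. Over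
the partition, the lengths sum to `N` and `M log M` sums to `N log N / 3 + O(N)`. The leading
coefficients are thus `28/9 + 2/3 - 1/18 = 67/18` for arithmetic and `1/36` for halvings, together
`15/4`. Shifts occur only at the leaves, and each array leaves at least one entry unshifted. -/

@[simp] theorem pure_eq_ret {V : Type} (a : α) : (pure a : Comp V α) = ret a := rfl

@[simp] theorem eval_ret (a : α) : (ret a : Comp ℝ α).eval = a := rfl

@[simp] theorem eval_bind (p : Comp ℝ α) (f : α → Comp ℝ β) :
    (p >>= f).eval = (f p.eval).eval := by
  change (p.bind f).eval = _
  induction p with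
  | ret a => rfl
  | add x y next ih => exact ih _
  | sub x y next ih => exact ih _
  | smul c x next ih => exact ih _
  | half x next ih => exact ih _
  | shift e x next ih => exact ih _

/-- The number of additions, subtractions and multiplications of a run. -/
def arith (p : Comp ℝ α) : ℕ := p.adds + p.muls

/-- A measure of runs that vanishes on `ret` and is additive under composition. -/
structure IsCost (c : ∀ {α : Type}, Comp ℝ α → ℕ) : Prop where
  ret : ∀ {α : Type} (a : α), c (Comp.ret a : Comp ℝ α) = 0
  bind : ∀ {α β : Type} (p : Comp ℝ α) (f : α → Comp ℝ β), c (p >>= f) = c p + c (f p.eval)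

theorem isCost_adds : IsCost (@adds) where
  ret _ := rfl
  bind p f := by
    change (p.bind f).adds = _
    induction p with
    | ret a => simp [Comp.bind, adds]
    | add x y next ih => simp only [Comp.bind, adds, eval, ih]; ring
    | sub x y next ih => simp only [Comp.bind, adds, eval, ih]; ring
    | smul c x next ih => simp only [Comp.bind, adds, eval, ih]
    | half x next ih => simp only [Comp.bind, adds, eval, ih]
    | shift e x next ih => simp only [Comp.bind, adds, eval, ih]

theorem isCost_muls : IsCost (@muls) where
  ret _ := rfl
  bind p f := by
    change (p.bind f).muls = _
    induction p with
    | ret a => simp [Comp.bind, muls]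
    | add x y next ih => simp only [Comp.bind, muls, eval, ih]
    | sub x y next ih => simp only [Comp.bind, muls, eval, ih]
    | smul c x next ih => simp only [Comp.bind, muls, eval, ih]; ring
    | half x next ih => simp only [Comp.bind, muls, eval, ih]
    | shift e x next ih => simp only [Comp.bind, muls, eval, ih]

theorem isCost_arith : IsCost (@arith) where
  ret _ := rfl
  bind p f := by
    simp only [arith, isCost_adds.bind, isCost_muls.bind]; ring

theorem isCost_halves : IsCost (@halves) where
  ret _ := rfl
  bind p f := by
    change (p.bind f).halves = _
    induction p with
    | ret a => simp [Comp.bind, halves]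
    | add x y next ih => simp only [Comp.bind, halves, eval, ih]
    | sub x y next ih => simp only [Comp.bind, halves, eval, ih]
    | smul c x next ih => simp only [Comp.bind, halves, eval, ih]
    | half x next ih => simp only [Comp.bind, halves, eval, ih]; ring
    | shift e x next ih => simp only [Comp.bind, halves, eval, ih]

theorem isCost_shifts : IsCost (@shifts) where
  ret _ := rfl
  bind p f := by
    change (p.bind f).shifts = _
    induction p with
    | ret a => simp [Comp.bind, shifts]
    | add x y next ih => simp only [Comp.bind, shifts, eval, ih]
    | sub x y next ih => simp only [Comp.bind, shifts, eval, ih]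
    | smul c x next ih => simp only [Comp.bind, shifts, eval, ih]
    | half x next ih => simp only [Comp.bind, shifts, eval, ih]
    | shift e x next ih => simp only [Comp.bind, shifts, eval, ih]; ring

@[simp] theorem eval_forEach : ∀ (m : ℕ) (f : Fin m → Comp ℝ α) (i : Fin m),
    (forEach m f).eval i = (f i).eval
  | 0, _, i => i.elim0
  | m + 1, f, i => by
    refine Fin.cases ?_ (fun i => ?_) i
    · simp [forEach]
    · simp [forEach, eval_forEach m]

theorem IsCost.forEach {c : ∀ {α : Type}, Comp ℝ α → ℕ} (hc : IsCost @c) :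
    ∀ (m : ℕ) (f : Fin m → Comp ℝ α), c (Comp.forEach m f) = ∑ i, c (f i)
  | 0, _ => by simp [Comp.forEach, hc.ret]
  | m + 1, f => by
    simp [Comp.forEach, hc.bind, hc.ret, IsCost.forEach hc m, Fin.sum_univ_succ]

theorem eval_foldlM (f : β → α → Comp ℝ β) (l : List α) (b : β) :
    (l.foldlM f b).eval = l.foldl (fun b a => (f b a).eval) b := by
  induction l generalizing b with
  | nil => rfl
  | cons a l ih => simp [ih]

theorem IsCost.foldlM {c : ∀ {α : Type}, Comp ℝ α → ℕ} (hc : IsCost @c)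
    (f : β → α → Comp ℝ β) (g : α → ℕ) (h : ∀ b a, c (f b a) = g a) (l : List α) (b : β) :
    c (l.foldlM f b) = (l.map g).sum := by
  induction l generalizing b with
  | nil => simp [hc.ret]
  | cons a l ih => simp [hc.bind, ih, h]

end Comp

open Whufft.Comp

theorem Comp.total_eq {α : Type} (p : Comp ℝ α) : p.total = p.arith + p.halves + p.shifts := rfl

/-- The complex number held by a pair of real registers. -/
def toC (x : ℝ × ℝ) : ℂ := ⟨x.1, x.2⟩

@[simp] theorem toC_cAdd (x y : ℝ × ℝ) : toC (cAdd x y).eval = toC x + toC y := rfl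
@[simp] theorem toC_cSub (x y : ℝ × ℝ) : toC (cSub x y).eval = toC x - toC y := rfl
@[simp] theorem toC_cSmul (c : ℝ) (x : ℝ × ℝ) : toC (cSmul c x).eval = c * toC x := by
  apply Complex.ext <;> simp [toC, cSmul, rSmul, eval]
@[simp] theorem toC_cHalf (x : ℝ × ℝ) : toC (cHalf x).eval = toC x / 2 := by
  apply Complex.ext <;> simp [toC, cHalf, eval]
@[simp] theorem toC_cShift (e : ℕ) (x : ℝ × ℝ) : toC (cShift e x).eval = 2 ^ e * toC x := by
  have : (2 : ℂ) ^ e = ((2 ^ e : ℝ) : ℂ) := by push_cast; rfl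
  rw [this]
  apply Complex.ext <;> simp [toC, cShift, eval, -Complex.ofReal_pow]

section Costs

variable (x y : ℝ × ℝ)

theorem arith_cAdd : (cAdd x y).arith = 2 := rfl
theorem arith_cSub : (cSub x y).arith = 2 := rfl
theorem arith_cHalf : (cHalf x).arith = 0 := rfl
theorem arith_cShift (e : ℕ) : (cShift e x).arith = 0 := rfl
theorem halves_cAdd : (cAdd x y).halves = 0 := rfl
theorem halves_cSub : (cSub x y).halves = 0 := rfl
theorem halves_cSmul (c : ℝ) : (cSmul c x).halves = 0 := rfl
theorem halves_cHalf : (cHalf x).halves = 2 := rfl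
theorem halves_cShift (e : ℕ) : (cShift e x).halves = 0 := rfl
theorem shifts_cAdd : (cAdd x y).shifts = 0 := rfl
theorem shifts_cSub : (cSub x y).shifts = 0 := rfl
theorem shifts_cSmul (c : ℝ) : (cSmul c x).shifts = 0 := rfl
theorem shifts_cHalf : (cHalf x).shifts = 0 := rfl
theorem shifts_cShift (e : ℕ) : (cShift e x).shifts = if e = 0 then 0 else 2 := by
  by_cases h : e = 0 <;> simp [cShift, shifts, h]

open Classical in
theorem arith_rSmul (c u : ℝ) :
    (rSmul c u).arith = if c = 0 ∨ c = 1 ∨ c = -1 then 0 else 1 := by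
  simp [rSmul, arith, adds, muls]

open Classical in
theorem arith_cSmul (c : ℝ) :
    (cSmul c x).arith = if c = 0 ∨ c = 1 ∨ c = -1 then 0 else 2 := by
  simp only [cSmul, isCost_arith.bind, arith_rSmul, pure_eq_ret, isCost_arith.ret]
  split_ifs <;> rfl

end Costs

/-- The complex numbers held by a vector, as a sequence indexed modulo the length. -/
def seq {n : ℕ} (x : CVec ℝ n) (i : ℕ) : ℂ := toC (x.get i)

theorem seq_val {n : ℕ} (x : CVec ℝ n) (i : Fin (2 ^ n)) : seq x i = toC (x i) := by
  simp [seq, CVec.get]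

theorem seq_mod {n : ℕ} (x : CVec ℝ n) (i : ℕ) : seq x (i % 2 ^ n) = seq x i := by
  simp [seq, CVec.get, Fin.ofNat]

theorem seq_of_lt {n : ℕ} (x : CVec ℝ n) {i : ℕ} (h : i < 2 ^ n) : seq x i = toC (x ⟨i, h⟩) :=
  seq_val x ⟨i, h⟩

theorem seq_subvector {n m : ℕ} (x : CVec ℝ n) (g : ℕ → ℕ) {i : ℕ} (h : i < 2 ^ m) :
    seq (n := m) (fun j => CVec.get x (g j)) i = seq x (g i) := by
  rw [seq_of_lt _ h]; rfl

/-! ### The Walsh-Hadamard transform -/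

/-- The entry `(i, j)` of the Walsh-Hadamard matrix of order `2 ^ m`, with indices taken modulo
`2 ^ m`. -/
def walsh : ℕ → ℕ → ℕ → ℂ
  | 0, _, _ => 1
  | m + 1, i, j => (if i % 2 = 1 ∧ j % 2 = 1 then -1 else 1) * walsh m (i / 2) (j / 2)

/-- The Walsh-Hadamard transform of order `2 ^ m`. -/
def hadamard (m : ℕ) (f : ℕ → ℂ) (i : ℕ) : ℂ := ∑ j ∈ Finset.range (2 ^ m), walsh m i j * f j

/-- The recursive definition peels off the lowest bit, which suits the interleaved arrays of the
partition. Splitting off the high bits instead is what the block recursion of the programs requires.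
-/
theorem walsh_add (m l i j : ℕ) :
    walsh (m + l) i j = walsh m i j * walsh l (i / 2 ^ m) (j / 2 ^ m) := by
  induction m generalizing i j with
  | zero => simp [walsh]
  | succ m ih =>
    rw [show m + 1 + l = (m + l) + 1 by ring]
    simp only [walsh, ih, Nat.div_div_eq_div_mul, pow_succ']
    ring

theorem walsh_mod (m i j : ℕ) : walsh m (i % 2 ^ m) (j % 2 ^ m) = walsh m i j := by
  induction m generalizing i j with
  | zero => simp [walsh]
  | succ m ih =>
    have h (i : ℕ) : i % 2 ^ (m + 1) / 2 = i / 2 % 2 ^ m := by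
      rw [pow_succ', Nat.mod_mul_right_div_self]
    have h' (i : ℕ) : i % 2 ^ (m + 1) % 2 = i % 2 :=
      Nat.mod_mod_of_dvd _ (dvd_pow_self 2 (Nat.succ_ne_zero m))
    simp only [walsh, h, h', ih]

theorem walsh_block (m l : ℕ) {i j : ℕ} (a b : ℕ) (hi : i < 2 ^ m) (hj : j < 2 ^ m) :
    walsh (m + l) (a * 2 ^ m + i) (b * 2 ^ m + j) = walsh m i j * walsh l a b := by
  have e (a : ℕ) {i : ℕ} (h : i < 2 ^ m) : (a * 2 ^ m + i) / 2 ^ m = a := by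
    rw [mul_comm, Nat.mul_add_div (by positivity), Nat.div_eq_of_lt h, add_zero]
  have e' (a : ℕ) {i : ℕ} (h : i < 2 ^ m) : (a * 2 ^ m + i) % 2 ^ m = i := by
    rw [mul_comm, Nat.mul_add_mod, Nat.mod_eq_of_lt h]
  rw [walsh_add, e a hi, e b hj, ← walsh_mod m (_ + _), e' a hi, e' b hj]

theorem sum_range_blocks (a b : ℕ) (g : ℕ → ℂ) :
    ∑ j ∈ Finset.range (a * b), g j =
      ∑ c ∈ Finset.range a, ∑ i ∈ Finset.range b, g (c * b + i) := by
  induction a with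
  | zero => simp
  | succ a ih => rw [Finset.sum_range_succ, ← ih, add_mul, one_mul, Finset.sum_range_add]

theorem hadamard_congr {m : ℕ} {f g : ℕ → ℂ} (h : ∀ j < 2 ^ m, f j = g j) (i : ℕ) :
    hadamard m f i = hadamard m g i :=
  Finset.sum_congr rfl fun j hj => by rw [h j (Finset.mem_range.1 hj)]

theorem hadamard_block (m l : ℕ) (f : ℕ → ℂ) (a : ℕ) {i : ℕ} (hi : i < 2 ^ m) :
    hadamard (m + l) f (a * 2 ^ m + i) =
      ∑ b ∈ Finset.range (2 ^ l), walsh l a b * hadamard m (fun j => f (b * 2 ^ m + j)) i := by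
  rw [hadamard, show 2 ^ (m + l) = 2 ^ l * 2 ^ m by ring, sum_range_blocks]
  refine Finset.sum_congr rfl fun b _ => ?_
  rw [hadamard, Finset.mul_sum]
  refine Finset.sum_congr rfl fun j hj => ?_
  rw [walsh_block m l a b hi (Finset.mem_range.1 hj)]
  ring

theorem hadamard_mul (m : ℕ) (c : ℂ) (f : ℕ → ℂ) (i : ℕ) :
    hadamard m (fun j => c * f j) i = c * hadamard m f i := by
  simp only [hadamard, mul_left_comm _ c, Finset.mul_sum]

theorem hadamard_succ_even (m : ℕ) (f : ℕ → ℂ) (i : ℕ) :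
    hadamard (m + 1) f (2 * i) = hadamard m (fun j => f (2 * j) + f (2 * j + 1)) i := by
  rw [hadamard, pow_succ, sum_range_blocks, hadamard]
  refine Finset.sum_congr rfl fun j _ => ?_
  have : (2 * j + 1) / 2 = j := by omega
  simp [Finset.sum_range_succ, walsh, mul_comm j 2, this]
  ring

theorem hadamard_succ_odd (m : ℕ) (f : ℕ → ℂ) (i : ℕ) :
    hadamard (m + 1) f (2 * i + 1) = hadamard m (fun j => f (2 * j) - f (2 * j + 1)) i := by
  rw [hadamard, pow_succ, sum_range_blocks, hadamard]
  refine Finset.sum_congr rfl fun j _ => ?_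
  have h (j : ℕ) : (2 * j + 1) / 2 = j := by omega
  have h' (j : ℕ) : (2 * j + 1) % 2 = 1 := by omega
  simp [Finset.sum_range_succ, walsh, mul_comm j 2, h, h']
  ring

theorem val_eq_block {m l : ℕ} (i : Fin (2 ^ (m + l))) :
    (i : ℕ) = (i : ℕ) / 2 ^ m * 2 ^ m + (Fin.ofNat (2 ^ m) (i : ℕ) : Fin (2 ^ m)) := by
  simp [Fin.ofNat, Nat.div_add_mod']

theorem toC_folkloreWHT : ∀ (m : ℕ) (x : CVec ℝ m) (i : Fin (2 ^ m)),
    toC ((folkloreWHT m x).eval i) = hadamard m (seq x) i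
  | 0, x, i => by
    obtain rfl : i = 0 := Fin.ext (Nat.lt_one_iff.1 i.2)
    simp [folkloreWHT, hadamard, walsh, ← seq_val]
  | m + 1, x, i => by
    have hi : (i : ℕ) / 2 ^ m < 2 := Nat.div_lt_of_lt_mul (by rw [← pow_succ]; exact i.2)
    have hlt := (Fin.ofNat (2 ^ m) (i : ℕ) : Fin (2 ^ m)).2
    rw [val_eq_block i, hadamard_block m 1 _ _ hlt]
    generalize hj : Fin.ofNat (2 ^ m) (i : ℕ) = j at *
    have h0 : hadamard m (seq (n := m) fun i => CVec.get x i) j = hadamard m (seq x) j :=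
      hadamard_congr (fun t ht => seq_subvector x (fun t => t) ht) _
    have h1 : hadamard m (seq (n := m) fun i => CVec.get x (2 ^ m + i)) j =
        hadamard m (fun t => seq x (2 ^ m + t)) j :=
      hadamard_congr (fun t ht => seq_subvector x (fun t => 2 ^ m + t) ht) _
    have key : ∀ a < 2, toC ((do
        let p ← cAdd ((folkloreWHT m fun i => CVec.get x i).eval j)
          ((folkloreWHT m fun i => CVec.get x (2 ^ m + i)).eval j)
        let q ← cSub ((folkloreWHT m fun i => CVec.get x i).eval j)
          ((folkloreWHT m fun i => CVec.get x (2 ^ m + i)).eval j)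
        pure ![p, q] : Comp ℝ (Fin 2 → ℝ × ℝ)).eval (Fin.ofNat 2 a)) =
        ∑ b ∈ Finset.range (2 ^ 1), walsh 1 a b *
          hadamard m (fun t => seq x (b * 2 ^ m + t)) j := by
      intro a ha
      interval_cases a
      · simp [Finset.sum_range_succ, walsh, toC_folkloreWHT m, h0, h1]
      · simp [Finset.sum_range_succ, walsh, toC_folkloreWHT m, h0, h1, sub_eq_add_neg]
    rw [← key _ hi]
    simp only [folkloreWHT, eval_bind, pure_eq_ret, eval_ret, eval_forEach, hj]

theorem toC_baseWHT (m k : ℕ) (x : CVec ℝ m) (i : Fin (2 ^ m)) :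
    toC ((baseWHT m k x).eval i) = 2 ^ k * hadamard m (seq x) i := by
  rw [baseWHT, eval_bind, toC_folkloreWHT, ← hadamard_mul]
  refine hadamard_congr (fun j hj => ?_) _
  rw [seq_of_lt _ hj, seq_of_lt _ hj, eval_forEach, toC_cShift]

/-- The non-rigidity of the order-8 matrix: each row but the first has `+1` at block 0 and at
exactly three other blocks. The common value `a - t` gives sign `-1` to all blocks but the first,
and adding a doubled block flips its sign to `+1`. Hence three additions of doubled blocks, partly
shared between rows, produce each output. -/
theorem toC_combine8 (w : Fin 8 → ℝ × ℝ) (A : ℕ → ℂ) (h0 : toC (w 0) = A 0)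
    (h : ∀ b : Fin 8, b ≠ 0 → toC (w b) = 2 * A b) (a : Fin 8) :
    toC ((combine8 w).eval a) = ∑ b ∈ Finset.range (2 ^ 3), walsh 3 a b * A b := by
  have h1 := h 1 (by decide)
  have h2 := h 2 (by decide)
  have h3 := h 3 (by decide)
  have h4 := h 4 (by decide)
  have h5 := h 5 (by decide)
  have h6 := h 6 (by decide)
  have h7 := h 7 (by decide)
  simp at h1 h2 h3 h4 h5 h6 h7
  fin_cases a <;>
    simp [combine8, Finset.sum_range_succ, walsh, h0, h1, h2, h3, h4, h5, h6, h7] <;> ring_nf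

theorem toC_wht : ∀ (m k : ℕ) (x : CVec ℝ m) (i : Fin (2 ^ m)),
    toC ((wht m k x).eval i) = 2 ^ k * hadamard m (seq x) i
  | 0, k, x, i => toC_baseWHT 0 k x i
  | 1, k, x, i => toC_baseWHT 1 k x i
  | 2, k, x, i => toC_baseWHT 2 k x i
  | m + 3, k, x, i => by
    have hi : (i : ℕ) / 2 ^ m < 8 := Nat.div_lt_of_lt_mul
      (by rw [show 2 ^ m * 8 = 2 ^ (m + 3) by ring]; exact i.2)
    have hlt := (Fin.ofNat (2 ^ m) (i : ℕ) : Fin (2 ^ m)).2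
    rw [val_eq_block i, hadamard_block m 3 _ _ hlt]
    generalize hj : Fin.ofNat (2 ^ m) (i : ℕ) = j at *
    rw [Finset.mul_sum]
    simp only [mul_left_comm (2 ^ k : ℂ)]
    obtain ⟨a, ha⟩ : ∃ a : Fin 8, (a : ℕ) = i / 2 ^ m := ⟨⟨_, hi⟩, rfl⟩
    have ha' : Fin.ofNat 8 ((i : ℕ) / 2 ^ m) = a := by rw [← ha]; simp
    have e (b : ℕ) : hadamard m (seq (n := m) fun i => CVec.get x (b * 2 ^ m + i)) j =
        hadamard m (fun t => seq x (b * 2 ^ m + t)) j :=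
      hadamard_congr (fun t ht => seq_subvector x (fun t => b * 2 ^ m + t) ht) _
    rw [← ha, ← toC_combine8 (fun b => (wht m (if b = 0 then k else k + 1)
      fun i => CVec.get x (b * 2 ^ m + i)).eval j) _ _ _ a]
    · simp only [wht, eval_bind, pure_eq_ret, eval_ret, eval_forEach, hj, ha']
    · rw [toC_wht m, if_pos rfl]
      simp only [← e]; rfl
    · intro b hb
      rw [toC_wht m, if_neg hb]
      simp only [← e]
      ring

/-! ### Costs of the Walsh-Hadamard transform -/

theorem arith_folkloreWHT : ∀ (m : ℕ) (x : CVec ℝ m),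
    (folkloreWHT m x).arith = 2 * 2 ^ m * m
  | 0, x => rfl
  | m + 1, x => by
    simp [folkloreWHT, isCost_arith.bind, isCost_arith.forEach, isCost_arith.ret,
      arith_folkloreWHT m, arith_cAdd, arith_cSub]
    ring

theorem halves_folkloreWHT : ∀ (m : ℕ) (x : CVec ℝ m), (folkloreWHT m x).halves = 0
  | 0, x => rfl
  | m + 1, x => by
    simp [folkloreWHT, isCost_halves.bind, isCost_halves.forEach, isCost_halves.ret,
      halves_folkloreWHT m, halves_cAdd, halves_cSub]

theorem shifts_folkloreWHT : ∀ (m : ℕ) (x : CVec ℝ m), (folkloreWHT m x).shifts = 0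
  | 0, x => rfl
  | m + 1, x => by
    simp [folkloreWHT, isCost_shifts.bind, isCost_shifts.forEach, isCost_shifts.ret,
      shifts_folkloreWHT m, shifts_cAdd, shifts_cSub]

theorem arith_baseWHT (m k : ℕ) (x : CVec ℝ m) : (baseWHT m k x).arith = 2 * 2 ^ m * m := by
  simp [baseWHT, isCost_arith.bind, isCost_arith.forEach, arith_cShift, arith_folkloreWHT]

theorem halves_baseWHT (m k : ℕ) (x : CVec ℝ m) : (baseWHT m k x).halves = 0 := by
  simp [baseWHT, isCost_halves.bind, isCost_halves.forEach, halves_cShift, halves_folkloreWHT]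

theorem shifts_baseWHT (m k : ℕ) (x : CVec ℝ m) :
    (baseWHT m k x).shifts = if k = 0 then 0 else 2 * 2 ^ m := by
  simp [baseWHT, isCost_shifts.bind, isCost_shifts.forEach, shifts_cShift, shifts_folkloreWHT]
  ring_nf

theorem arith_combine8 (w : Fin 8 → ℝ × ℝ) : (combine8 w).arith = 44 := by
  simp only [combine8, isCost_arith.bind, pure_eq_ret, isCost_arith.ret, arith_cAdd, arith_cSub,
    arith_cHalf]

theorem halves_combine8 (w : Fin 8 → ℝ × ℝ) : (combine8 w).halves = 2 := by
  simp only [combine8, isCost_halves.bind, pure_eq_ret, isCost_halves.ret, halves_cAdd, halves_cSub,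
    halves_cHalf]

theorem shifts_combine8 (w : Fin 8 → ℝ × ℝ) : (combine8 w).shifts = 0 := by
  simp only [combine8, isCost_shifts.bind, pure_eq_ret, isCost_shifts.ret, shifts_cAdd, shifts_cSub,
    shifts_cHalf]

/-- There are `⌊m/3⌋` levels of order-8 steps, and each level halves one complex number per eight
entries. The factor 4 keeps the count in `ℕ`. -/
theorem four_mul_halves_wht : ∀ (m k : ℕ) (x : CVec ℝ m),
    4 * (wht m k x).halves = 2 ^ m * (m / 3)
  | 0, k, x => by simp [wht, halves_baseWHT]
  | 1, k, x => by simp [wht, halves_baseWHT]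
  | 2, k, x => by simp [wht, halves_baseWHT]
  | m + 3, k, x => by
    simp only [wht, isCost_halves.bind, isCost_halves.forEach, pure_eq_ret, isCost_halves.ret,
      halves_combine8, mul_add, Finset.mul_sum, four_mul_halves_wht m]
    simp
    ring

/-- Each of the `⌊m/3⌋` order-8 levels saves 4 of the 48 real additions that three folklore levels
spend on eight entries. The saving stands on the left to avoid truncated subtraction. -/
theorem two_mul_arith_wht : ∀ (m k : ℕ) (x : CVec ℝ m),
    2 * (wht m k x).arith + 2 ^ m * (m / 3) = 4 * 2 ^ m * m
  | 0, k, x => by simp [wht, arith_baseWHT]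
  | 1, k, x => by simp [wht, arith_baseWHT]
  | 2, k, x => by simp [wht, arith_baseWHT]
  | m + 3, k, x => by
    have ih (k : ℕ) (x : CVec ℝ m) : 2 * (wht m k x).arith = 4 * 2 ^ m * m - 2 ^ m * (m / 3) := by
      have := two_mul_arith_wht m k x
      omega
    -- The induction hypothesis at a dummy vector shows that the truncated subtraction in `ih` is a
    -- true one, as `zify` needs.
    have hle : 2 ^ m * (m / 3) ≤ 4 * 2 ^ m * m := by
      have := two_mul_arith_wht m k (fun _ => 0)
      omega
    simp only [wht, isCost_arith.bind, isCost_arith.forEach, pure_eq_ret, isCost_arith.ret,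
      arith_combine8, mul_add, Finset.mul_sum, ih]
    rw [Nat.add_div_right m three_pos]
    generalize m / 3 = q at hle ⊢
    zify [hle]
    simp
    ring

/-- The exponent only grows down the recursion, so every entry is shifted exactly once, in its base
case. -/
theorem shifts_wht_of_pos : ∀ (m k : ℕ) (x : CVec ℝ m), k ≠ 0 →
    (wht m k x).shifts = 2 * 2 ^ m
  | 0, k, x, hk => by simp [wht, shifts_baseWHT, hk]
  | 1, k, x, hk => by simp [wht, shifts_baseWHT, hk]
  | 2, k, x, hk => by simp [wht, shifts_baseWHT, hk]
  | m + 3, k, x, hk => by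
    have ih (b : Fin 8) (x : CVec ℝ m) :
        (wht m (if b = 0 then k else k + 1) x).shifts = 2 * 2 ^ m :=
      shifts_wht_of_pos m _ x (by split_ifs <;> omega)
    simp only [wht, isCost_shifts.bind, isCost_shifts.forEach, pure_eq_ret, isCost_shifts.ret,
      shifts_combine8, ih]
    simp
    ring

/-- Following first blocks down the recursion, the exponent stays 0 and the base case reached shifts
nothing, which saves at least one complex entry. -/
theorem shifts_wht_zero_le : ∀ (m : ℕ) (x : CVec ℝ m),
    (wht m 0 x).shifts + 2 ≤ 2 * 2 ^ m
  | 0, x => by simp [wht, shifts_baseWHT]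
  | 1, x => by simp [wht, shifts_baseWHT]
  | 2, x => by simp [wht, shifts_baseWHT]
  | m + 3, x => by
    have ih := shifts_wht_zero_le m (fun i => CVec.get x (0 * 2 ^ m + i))
    simp only [wht, isCost_shifts.bind, isCost_shifts.forEach, pure_eq_ret, isCost_shifts.ret,
      shifts_combine8, Fin.sum_univ_succ (n := 7)]
    simp [shifts_wht_of_pos m 1 _ one_ne_zero] at ih ⊢
    rw [pow_add]
    omega

/-! ### The transform `H'` -/

theorem sum_partition : ∀ n : ℕ, ((partition n).map fun s => 2 ^ s.1).sum = 2 ^ n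
  | 0 => rfl
  | 1 => rfl
  | n + 2 => by
    have : ((partition n).map fun s => 2 ^ (s.1 + 1)).sum = 2 * 2 ^ n := by
      simp only [pow_succ', List.sum_map_mul_left, sum_partition n]
    simp only [partition, List.map_append, List.map_map, Function.comp_def, List.sum_append, this,
      sum_partition (n + 1)]
    ring

theorem partition_lt : ∀ (n : ℕ), ∀ s ∈ partition n, ∀ j, s.2 j < 2 ^ n
  | 0 => by simp [partition]
  | 1 => by simp [partition]
  | n + 2 => by
    intro s hs j
    rw [partition, List.mem_append, List.mem_map] at hs
    rcases hs with hs | ⟨t, ht, rfl⟩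
    · have := partition_lt (n + 1) s hs j
      rw [pow_succ] at this ⊢
      omega
    · have := partition_lt n t ht (Fin.ofNat (2 ^ t.1) (j / 2))
      simp only [pow_succ]
      split_ifs <;> omega

theorem splitRadixIndex_even (n : ℕ) {i : ℕ} (h : i < 2 ^ (n + 1)) :
    splitRadixIndex (n + 2) i = 2 * splitRadixIndex (n + 1) i := by
  rw [splitRadixIndex, if_pos (by rw [pow_succ] at h; omega)]

theorem splitRadixIndex_one (n : ℕ) {i : ℕ} (h : i < 2 ^ n) :
    splitRadixIndex (n + 2) (i + 2 * 2 ^ n) = 4 * splitRadixIndex n i + 1 := by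
  rw [splitRadixIndex, if_neg (by omega), if_pos (by omega), Nat.add_sub_cancel]

theorem splitRadixIndex_neg_one (n i : ℕ) :
    splitRadixIndex (n + 2) (i + 3 * 2 ^ n) =
      (4 * splitRadixIndex n i + (4 * 2 ^ n - 1)) % (4 * 2 ^ n) := by
  rw [splitRadixIndex, if_neg (by omega), if_neg (by omega), Nat.add_sub_cancel]

/-- The arrays of the partition, read in split-radix order, meet all indices. -/
theorem exists_position : ∀ (n p : ℕ), p < 2 ^ n →
    ∃ s ∈ partition n, ∃ j, splitRadixIndex n (s.2 j) = p
  | 0, p, hp => ⟨_, List.mem_singleton_self _, 0, by simp_all [splitRadixIndex]⟩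
  | 1, p, hp => by
    interval_cases p
    · exact ⟨⟨0, fun _ => 0⟩, by simp [partition], 0, rfl⟩
    · exact ⟨⟨0, fun _ => 1⟩, by simp [partition], 0, rfl⟩
  | n + 2, p, hp => by
    have hN : 0 < 2 ^ n := by positivity
    have hp' : p < 4 * 2 ^ n := by rw [pow_succ, pow_succ] at hp; omega
    have odd (q : ℕ) (hq : q < 2 ^ n) : ∃ s ∈ partition n, ∃ (j : Fin (2 ^ s.1)) (i : ℕ),
        s.2 j = i ∧ i < 2 ^ n ∧ splitRadixIndex n i = q := by
      obtain ⟨s, hs, j, h⟩ := exists_position n q hq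
      exact ⟨s, hs, j, _, rfl, partition_lt n s hs j, h⟩
    obtain ⟨q, rfl | rfl⟩ := Nat.even_or_odd' p
    · obtain ⟨s, hs, j, h⟩ := exists_position (n + 1) q (by rw [pow_succ]; omega)
      refine ⟨s, by rw [partition]; exact List.mem_append_left _ hs, j, ?_⟩
      rw [splitRadixIndex_even n (partition_lt _ s hs j), h]
    · obtain ⟨t, rfl | rfl⟩ := Nat.even_or_odd' q
      · obtain ⟨s, hs, j, i, hj, hi, h⟩ := odd t (by omega)
        refine ⟨_, by rw [partition]; exact List.mem_append_right _ (List.mem_map_of_mem hs),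
          ⟨2 * j, by rw [pow_succ]; omega⟩, ?_⟩
        simp only [Nat.mul_div_cancel_left _ two_pos, Nat.mul_mod_right, if_true]
        rw [show Fin.ofNat (2 ^ s.1) (j : ℕ) = j by simp, hj, splitRadixIndex_one n hi, h]
        ring
      -- Position `4t + 3` is `4(t + 1) - 1`. For the last `t` the quarter index wraps to 0, whose
      -- position is `N - 1`.
      · obtain ⟨s, hs, j, i, hj, hi, h⟩ := odd ((t + 1) % 2 ^ n) (Nat.mod_lt _ hN)
        refine ⟨_, by rw [partition]; exact List.mem_append_right _ (List.mem_map_of_mem hs),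
          ⟨2 * j + 1, by rw [pow_succ]; omega⟩, ?_⟩
        simp only [show (2 * (j : ℕ) + 1) / 2 = j by omega, show (2 * (j : ℕ) + 1) % 2 = 1 by omega,
          one_ne_zero, if_false]
        rw [show Fin.ofNat (2 ^ s.1) (j : ℕ) = j by simp, hj, splitRadixIndex_neg_one, h]
        by_cases ht : t + 1 = 2 ^ n
        · rw [ht, Nat.mod_self, Nat.mod_eq_of_lt] <;> omega
        · rw [Nat.mod_eq_of_lt (by omega : t + 1 < 2 ^ n),
            show 4 * (t + 1) + (4 * 2 ^ n - 1) = 2 * (2 * t + 1) + 1 + 4 * 2 ^ n by omega,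
            Nat.add_mod_right, Nat.mod_eq_of_lt hp']

/-! ### Successive assignments to distinct positions -/

theorem foldl_update_of_notMem {ι α : Type*} [DecidableEq ι] (l : List (ι × α)) (y : ι → α) (i : ι)
    (h : i ∉ l.map Prod.fst) :
    l.foldl (fun y e => Function.update y e.1 e.2) y i = y i := by
  induction l generalizing y with
  | nil => rfl
  | cons e l ih =>
    simp only [List.map_cons, List.mem_cons, not_or] at h
    rw [List.foldl_cons, ih _ h.2, Function.update_of_ne h.1]

theorem foldl_update_of_mem {ι α : Type*} [DecidableEq ι] (l : List (ι × α)) (y : ι → α)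
    (hl : (l.map Prod.fst).Nodup) {e : ι × α} (he : e ∈ l) :
    l.foldl (fun y e => Function.update y e.1 e.2) y e.1 = e.2 := by
  induction l generalizing y with
  | nil => simp at he
  | cons a l ih =>
    simp only [List.map_cons, List.nodup_cons] at hl
    rw [List.foldl_cons]
    rcases List.mem_cons.1 he with rfl | he
    · rw [foldl_update_of_notMem _ _ _ hl.1, Function.update_self]
    · exact ih _ hl.2 he

/-- The assignments performed by `hPrime`, in order. -/
def assignments (n : ℕ) (x : CVec ℝ n) : List (Fin (2 ^ n) × (ℝ × ℝ)) :=
  (partition n).flatMap fun s => (List.finRange (2 ^ s.1)).map fun j =>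
    (Fin.ofNat (2 ^ n) (splitRadixIndex n (s.2 j)),
      (wht s.1 0 fun j => CVec.get x (splitRadixIndex n (s.2 j))).eval j)

theorem eval_hPrime (n : ℕ) (x : CVec ℝ n) :
    (hPrime n x).eval = (assignments n x).foldl (fun y e => Function.update y e.1 e.2) x := by
  rw [hPrime, eval_foldlM, assignments, List.foldl_flatMap]
  simp only [List.foldl_map, eval_bind, pure_eq_ret, eval_ret, CVec.write]

/-- A counting argument: there are `2 ^ n` assignments by `sum_partition`, and they meet all `2 ^ n`
positions by `exists_position`. -/
theorem nodup_assignments (n : ℕ) (x : CVec ℝ n) : ((assignments n x).map Prod.fst).Nodup := by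
  have hlen : ((assignments n x).map Prod.fst).length = 2 ^ n := by
    simp [assignments, List.length_flatMap, sum_partition]
  rw [← Multiset.coe_nodup, ← Multiset.toFinset_card_eq_card_iff_nodup]
  have : Multiset.toFinset (((assignments n x).map Prod.fst : List _) : Multiset (Fin (2 ^ n))) =
      Finset.univ := by
    ext p
    obtain ⟨s, hs, j, h⟩ := exists_position n p p.2
    simp only [Multiset.mem_toFinset, Multiset.mem_coe, Finset.mem_univ, iff_true, assignments,
      List.map_flatMap, List.mem_flatMap, List.map_map, List.mem_map, Function.comp_apply]
    exact ⟨s, hs, j, List.mem_finRange j, by rw [h]; simp⟩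
  rw [this, Multiset.coe_card, hlen, Finset.card_univ, Fintype.card_fin]

/-- `g` arises from `f` by Walsh-Hadamard transforms on the arrays of the partition. -/
def IsUprooted (n : ℕ) (f g : ℕ → ℂ) : Prop :=
  ∀ s ∈ partition n, ∀ j : Fin (2 ^ s.1), g (splitRadixIndex n (s.2 j)) =
    hadamard s.1 (fun t => f (splitRadixIndex n (s.2 (Fin.ofNat (2 ^ s.1) t)))) j

/-- Each array is read from the original input rather than from the partly overwritten vector, so it
suffices that no position is written twice. -/
theorem isUprooted_hPrime (n : ℕ) (x : CVec ℝ n) :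
    IsUprooted n (seq x) (seq (hPrime n x).eval) := by
  intro s hs j
  have h := foldl_update_of_mem (assignments n x) x (nodup_assignments n x)
    (List.mem_flatMap.2 ⟨s, hs, List.mem_map.2 ⟨j, List.mem_finRange j, rfl⟩⟩)
  rw [seq, CVec.get, eval_hPrime, h, toC_wht, pow_zero, one_mul]
  refine hadamard_congr (fun t ht => ?_) _
  rw [seq_of_lt _ ht, seq]
  simp [Fin.ofNat, Nat.mod_eq_of_lt ht]

theorem IsUprooted.even {n : ℕ} {f g : ℕ → ℂ} (h : IsUprooted (n + 2) f g) :
    IsUprooted (n + 1) (fun i => f (2 * i)) (fun i => g (2 * i)) := by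
  intro s hs j
  have := h s (by rw [partition]; exact List.mem_append_left _ hs) j
  simpa only [splitRadixIndex_even n (partition_lt _ s hs _)] using this

/-- In a doubled array the entries `i + N/2` and `i + 3N/4` are neighbours, sitting at positions
`4π(i) + 1` and `4π(i) - 1`. Splitting off the lowest bit of the Walsh-Hadamard transform turns its
even outputs into a shorter transform of the sums of neighbours and its odd outputs into one of the
differences. -/
theorem IsUprooted.odd {n : ℕ} {f g : ℕ → ℂ} (h : IsUprooted (n + 2) f g)
    (hf : Function.Periodic f (2 ^ (n + 2))) (hg : Function.Periodic g (2 ^ (n + 2))) :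
    IsUprooted n (fun i => f (4 * i + 1) + f (4 * i + (2 ^ (n + 2) - 1)))
      (fun i => g (4 * i + 1)) ∧
    IsUprooted n (fun i => f (4 * i + 1) - f (4 * i + (2 ^ (n + 2) - 1)))
      (fun i => g (4 * i + (2 ^ (n + 2) - 1))) := by
  have h4 : 2 ^ (n + 2) = 4 * 2 ^ n := by ring
  have key (s) (hs : s ∈ partition n) (a : ℕ) (ha : a < 2 ^ (s.1 + 1)) :=
    h _ (by rw [partition]; exact List.mem_append_right _ (List.mem_map_of_mem hs)) ⟨a, ha⟩
  have val (s : Σ m : ℕ, Fin (2 ^ m) → ℕ) (hs : s ∈ partition n) (f : ℕ → ℂ)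
      (hf : Function.Periodic f (2 ^ (n + 2))) (a : ℕ) :
      f (splitRadixIndex (n + 2) (s.2 (Fin.ofNat (2 ^ s.1) a) + 2 * 2 ^ n)) =
        f (4 * splitRadixIndex n (s.2 (Fin.ofNat (2 ^ s.1) a)) + 1) ∧
      f (splitRadixIndex (n + 2) (s.2 (Fin.ofNat (2 ^ s.1) a) + 3 * 2 ^ n)) =
        f (4 * splitRadixIndex n (s.2 (Fin.ofNat (2 ^ s.1) a)) + (2 ^ (n + 2) - 1)) := by
    have hlt := partition_lt n s hs (Fin.ofNat (2 ^ s.1) a)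
    rw [splitRadixIndex_one n hlt, splitRadixIndex_neg_one, ← h4, hf.map_mod_nat]
    exact ⟨rfl, rfl⟩
  have inner (s : Σ m : ℕ, Fin (2 ^ m) → ℕ) (t : ℕ) (ht : t < 2 ^ s.1) :
      ((2 * t) % 2 ^ (s.1 + 1) / 2 = t ∧ (2 * t) % 2 ^ (s.1 + 1) % 2 = 0) ∧
      ((2 * t + 1) % 2 ^ (s.1 + 1) / 2 = t ∧ (2 * t + 1) % 2 ^ (s.1 + 1) % 2 = 1) := by
    have h0 : 2 * t < 2 ^ (s.1 + 1) := by rw [pow_succ]; omega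
    have h1 : 2 * t + 1 < 2 ^ (s.1 + 1) := by rw [pow_succ]; omega
    rw [Nat.mod_eq_of_lt h0, Nat.mod_eq_of_lt h1]
    omega
  constructor
  · intro s hs j
    have e := key s hs (2 * j) (by rw [pow_succ]; omega)
    simp only [Nat.mul_div_cancel_left _ two_pos, Nat.mul_mod_right, if_true,
      hadamard_succ_even] at e
    rw [(val s hs g hg j).1] at e
    simp only [Fin.ofNat_val_eq_self] at e
    refine e.trans (hadamard_congr (fun t ht => ?_) _)
    obtain ⟨⟨h1, h2⟩, h3, h4⟩ := inner s t ht
    simp only [Fin.ofNat, h1, h2, h3, h4, if_true, one_ne_zero, if_false]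
    exact congrArg₂ _ (val s hs f hf t).1 (val s hs f hf t).2
  · intro s hs j
    have e := key s hs (2 * j + 1) (by rw [pow_succ]; omega)
    simp only [show (2 * (j : ℕ) + 1) / 2 = j by omega, show (2 * (j : ℕ) + 1) % 2 = 1 by omega,
      one_ne_zero, if_false, hadamard_succ_odd] at e
    rw [(val s hs g hg j).2] at e
    simp only [Fin.ofNat_val_eq_self] at e
    refine e.trans (hadamard_congr (fun t ht => ?_) _)
    obtain ⟨⟨h1, h2⟩, h3, h4⟩ := inner s t ht
    simp only [Fin.ofNat, h1, h2, h3, h4, if_true, one_ne_zero, if_false]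
    exact congrArg₂ _ (val s hs f hf t).1 (val s hs f hf t).2

/-! ### Angles and scale factors -/

/-- The angle `2πk / N` for `N = 2 ^ n`. -/
def angle (n k : ℕ) : ℝ := 2 * Real.pi * k / 2 ^ n

/-- `max |cos θ| |sin θ|`. -/
def amp (θ : ℝ) : ℝ := max |Real.cos θ| |Real.sin θ|

theorem angle_add (n k : ℕ) : angle (n + 2) (k + 2 ^ n) = angle (n + 2) k + Real.pi / 2 := by
  simp only [angle, pow_add]
  push_cast
  field_simp

theorem amp_add_pi_div_two (θ : ℝ) : amp (θ + Real.pi / 2) = amp θ := by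
  rw [amp, amp, Real.cos_add_pi_div_two, Real.sin_add_pi_div_two, abs_neg, max_comm]

theorem amp_pos (θ : ℝ) : 0 < amp θ := by
  rw [amp, lt_max_iff, abs_pos, abs_pos]
  by_contra! h
  have := Real.sin_sq_add_cos_sq θ
  simp [h.1, h.2] at this

theorem amp_le_one (θ : ℝ) : amp θ ≤ 1 :=
  max_le (Real.abs_cos_le_one θ) (Real.abs_sin_le_one θ)

theorem amp_eq_cos {θ : ℝ} (h0 : 0 ≤ θ) (h1 : θ ≤ Real.pi / 4) : amp θ = Real.cos θ := by
  have hpi := Real.pi_pos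
  have hc : 0 ≤ Real.cos θ := Real.cos_nonneg_of_mem_Icc ⟨by linarith, by linarith⟩
  have hs : 0 ≤ Real.sin θ := Real.sin_nonneg_of_nonneg_of_le_pi h0 (by linarith)
  rw [amp, abs_of_nonneg hc, abs_of_nonneg hs, max_eq_left]
  rw [← Real.cos_pi_div_two_sub]
  exact Real.cos_le_cos_of_nonneg_of_le_pi h0 (by linarith) (by linarith)

theorem amp_eq_sin {θ : ℝ} (h0 : Real.pi / 4 ≤ θ) (h1 : θ ≤ Real.pi / 2) :
    amp θ = Real.sin θ := by
  have h := amp_eq_cos (θ := Real.pi / 2 - θ) (by linarith) (by linarith)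
  rw [Real.cos_pi_div_two_sub] at h
  rw [← h, amp, amp, Real.cos_pi_div_two_sub, Real.sin_pi_div_two_sub, max_comm]

theorem amp_angle_mod (n k : ℕ) : amp (angle (n + 2) (k % 2 ^ n)) = amp (angle (n + 2) k) := by
  have : Function.Periodic (fun k => amp (angle (n + 2) k)) (2 ^ n) := fun k => by
    simp only [angle_add, amp_add_pi_div_two]
  exact this.map_mod_nat k

theorem scale_mod : ∀ n k : ℕ, scale (n + 2) (k % 2 ^ n) = scale (n + 2) k
  | 0, k => rfl
  | n + 1, k => by rw [scale, scale]; simp only [Nat.mod_mod]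

theorem scale_add_pow (n k : ℕ) : scale (n + 2) (k + 2 ^ n) = scale (n + 2) k := by
  rw [← scale_mod, Nat.add_mod_right, scale_mod]

theorem scale_mod_of_le {n m : ℕ} (k : ℕ) (h : n ≤ m + 2) : scale n (k % 2 ^ m) = scale n k := by
  match n with
  | 0 => rfl
  | 1 => rfl
  | n + 2 =>
    rw [← scale_mod n, Nat.mod_mod_of_dvd _ (pow_dvd_pow 2 (by omega)), scale_mod]

/-- The case distinction in the definition picks the larger of cosine and sine on the first
quadrant. Since `amp` has period `π/2`, the formula holds without reducing `k`, and it replaces the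
definition from here on. -/
theorem scale_add_two (n k : ℕ) : scale (n + 2) k = scale n k * amp (angle (n + 2) k) := by
  rw [← amp_angle_mod]
  match n with
  | 0 => simp [scale, angle, Nat.mod_one, amp]
  | e + 1 =>
    have hpi := Real.pi_pos
    have hlt : k % 2 ^ (e + 1) < 2 ^ (e + 1) := Nat.mod_lt _ (by positivity)
    have hk : scale (e + 1) k = scale (e + 1) (k % 2 ^ (e + 1)) :=
      (scale_mod_of_le k (by omega)).symm
    rw [hk, scale]
    generalize k % 2 ^ (e + 1) = κ at *
    have hθ : (2 * Real.pi * κ / 2 ^ (e + 3) : ℝ) = angle (e + 1 + 2) κ := rfl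
    have hθ' : angle (e + 1 + 2) κ = Real.pi / 4 * (κ / 2 ^ e) := by
      rw [angle, pow_add, pow_add]; field_simp; ring
    have hp : (0 : ℝ) < 2 ^ e := by positivity
    simp only [hθ]
    split_ifs with h
    · have h' : (κ : ℝ) / 2 ^ e ≤ 1 := (div_le_one hp).2 (by exact_mod_cast h)
      rw [amp_eq_cos]
      · rw [hθ']; positivity
      · rw [hθ']; exact mul_le_of_le_one_right (by positivity) h'
    · have h1 : 1 ≤ (κ : ℝ) / 2 ^ e := (one_le_div hp).2 (by exact_mod_cast (not_le.1 h).le)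
      have h2 : (κ : ℝ) / 2 ^ e ≤ 2 := (div_le_iff₀ hp).2 (by
        rw [pow_succ'] at hlt
        exact_mod_cast hlt.le)
      rw [amp_eq_sin] <;> rw [hθ'] <;> nlinarith

theorem scale_pos : ∀ n k : ℕ, 0 < scale n k
  | 0, k => one_pos
  | 1, k => one_pos
  | n + 2, k => by
    rw [scale_add_two]
    exact mul_pos (scale_pos n k) (amp_pos _)

theorem scale_le_one : ∀ n k : ℕ, scale n k ≤ 1
  | 0, k => le_rfl
  | 1, k => le_rfl
  | n + 2, k => by
    rw [scale_add_two]
    exact mul_le_one₀ (scale_le_one n k) (amp_pos _).le (amp_le_one _)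

theorem scale_zero_right : ∀ n : ℕ, scale n 0 = 1
  | 0 => rfl
  | 1 => rfl
  | n + 2 => by
    rw [scale_add_two, scale_zero_right n]
    simp [angle, amp]

/-! ### Roots of unity and the discrete Fourier transform -/

theorem omega_pow (n k : ℕ) : omega (2 ^ n) ^ k = Complex.exp (-(angle n k : ℂ) * Complex.I) := by
  rw [omega, ← Complex.exp_nat_mul, angle]
  congr 1
  push_cast
  ring

theorem omega_pow_eq (n k : ℕ) :
    omega (2 ^ n) ^ k = (Real.cos (angle n k) : ℂ) - (Real.sin (angle n k) : ℂ) * Complex.I := by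
  rw [omega_pow, Complex.exp_mul_I, Complex.cos_neg, Complex.sin_neg]
  push_cast
  ring

theorem omega_pow_inv (n k : ℕ) :
    (omega (2 ^ n) ^ k)⁻¹ =
      (Real.cos (angle n k) : ℂ) + (Real.sin (angle n k) : ℂ) * Complex.I := by
  rw [omega_pow, ← Complex.exp_neg, neg_mul, neg_neg, Complex.exp_mul_I]
  push_cast
  ring

theorem omega_ne_zero (N : ℕ) : omega N ≠ 0 := Complex.exp_ne_zero _

theorem omega_pow_self (n : ℕ) : omega (2 ^ n) ^ 2 ^ n = 1 := by
  rw [omega_pow, angle, Complex.exp_eq_one_iff]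
  refine ⟨-1, ?_⟩
  push_cast
  field_simp

theorem omega_sq (n : ℕ) : omega (2 ^ (n + 1)) ^ 2 = omega (2 ^ n) := by
  rw [omega, omega, ← Complex.exp_nat_mul]
  congr 1
  push_cast
  rw [pow_succ]
  field_simp

theorem omega_pow_four (n : ℕ) : omega (2 ^ (n + 2)) ^ 4 = omega (2 ^ n) := by
  rw [← omega_sq n, ← omega_sq (n + 1), ← pow_mul]

theorem omega_pow_add (n k : ℕ) :
    omega (2 ^ (n + 2)) ^ (k + 2 ^ n) = -Complex.I * omega (2 ^ (n + 2)) ^ k := by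
  rw [omega_pow_eq, omega_pow_eq, angle_add, Real.cos_add_pi_div_two, Real.sin_add_pi_div_two]
  push_cast
  linear_combination (-Complex.sin (angle (n + 2) k)) * Complex.I_sq

/-- The discrete Fourier transform of order `2 ^ n` of a sequence. -/
def dft (n : ℕ) (f : ℕ → ℂ) (k : ℕ) : ℂ :=
  ∑ t ∈ Finset.range (2 ^ n), omega (2 ^ n) ^ (t * k) * f t

theorem dft_add_pow (n : ℕ) (f : ℕ → ℂ) (k : ℕ) : dft n f (k + 2 ^ n) = dft n f k := by
  refine Finset.sum_congr rfl fun t _ => ?_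
  rw [mul_add, pow_add, mul_comm t (2 ^ n), pow_mul _ (2 ^ n), omega_pow_self, one_pow, mul_one]

theorem dft_add (n : ℕ) (f g : ℕ → ℂ) (k : ℕ) :
    dft n (fun t => f t + g t) k = dft n f k + dft n g k := by
  simp only [dft, mul_add, Finset.sum_add_distrib]

theorem dft_sub (n : ℕ) (f g : ℕ → ℂ) (k : ℕ) :
    dft n (fun t => f t - g t) k = dft n f k - dft n g k := by
  simp only [dft, mul_sub, Finset.sum_sub_distrib]

theorem sum_range_rotate {M : ℕ} (hM : 0 < M) {h : ℕ → ℂ} (hh : Function.Periodic h M) :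
    ∑ j ∈ Finset.range M, h (j + (M - 1)) = ∑ j ∈ Finset.range M, h j := by
  obtain ⟨m, rfl⟩ := Nat.exists_eq_add_of_le' hM
  rw [Finset.sum_range_succ', Finset.sum_range_succ]
  simp only [Nat.add_sub_cancel, zero_add]
  congr 1
  exact Finset.sum_congr rfl fun j _ => by rw [add_assoc, add_comm 1 m, hh]

/-- Modulo the period, the indices `4j - 1` are the residue class of 3 modulo 4, rotated by one
place. -/
theorem sum_range_splitRadix {M : ℕ} (hM : 0 < M) {g : ℕ → ℂ} (hg : Function.Periodic g (4 * M)) :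
    ∑ t ∈ Finset.range (4 * M), g t = ∑ j ∈ Finset.range (2 * M), g (2 * j) +
      ∑ j ∈ Finset.range M, g (4 * j + 1) + ∑ j ∈ Finset.range M, g (4 * j + (4 * M - 1)) := by
  have h3 : ∑ j ∈ Finset.range M, g (4 * j + (4 * M - 1)) =
      ∑ j ∈ Finset.range M, g (4 * j + 3) := by
    rw [← sum_range_rotate hM (h := fun j => g (4 * j + 3))]
    · exact Finset.sum_congr rfl fun j _ => congrArg g (by omega)
    · intro j
      simp only [mul_add, add_right_comm _ _ 3, hg _]
  rw [h3, mul_comm 4, mul_comm 2, sum_range_blocks, sum_range_blocks]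
  simp only [Finset.sum_range_succ, Finset.sum_range_zero, Finset.sum_add_distrib, mul_add,
    mul_comm _ 4, mul_comm _ 2, ← mul_assoc]
  norm_num
  ring

theorem dft_splitRadix (n : ℕ) {f : ℕ → ℂ} (hf : Function.Periodic f (2 ^ (n + 2))) (k : ℕ) :
    dft (n + 2) f k = dft (n + 1) (fun t => f (2 * t)) k +
      omega (2 ^ (n + 2)) ^ k * dft n (fun t => f (4 * t + 1)) k +
      (omega (2 ^ (n + 2)) ^ k)⁻¹ * dft n (fun t => f (4 * t + (2 ^ (n + 2) - 1))) k := by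
  have h4 : 2 ^ (n + 2) = 4 * 2 ^ n := by ring
  have hN : 0 < 2 ^ n := by positivity
  have hg : Function.Periodic (fun t => omega (2 ^ (n + 2)) ^ (t * k) * f t) (4 * 2 ^ n) := by
    intro t
    simp only [← h4, hf t, add_mul, pow_add _ (t * k), pow_mul _ (2 ^ (n + 2)), omega_pow_self,
      one_pow, mul_one]
  have hr : Finset.range (2 ^ (n + 2)) = Finset.range (4 * 2 ^ n) := by rw [h4]
  rw [dft, hr, sum_range_splitRadix hN hg, ← h4]
  simp only [dft, Finset.mul_sum]
  rw [pow_succ' 2 n]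
  congr 1
  · congr 1
    · refine Finset.sum_congr rfl fun t _ => ?_
      rw [mul_assoc 2 t k, pow_mul, omega_sq, ← pow_succ']
    · refine Finset.sum_congr rfl fun t _ => ?_
      rw [add_mul, pow_add, one_mul, mul_assoc 4 t k, pow_mul, omega_pow_four]
      ring
  · refine Finset.sum_congr rfl fun t _ => ?_
    have : omega (2 ^ (n + 2)) ^ ((4 * t + (2 ^ (n + 2) - 1)) * k) =
        (omega (2 ^ (n + 2)) ^ k)⁻¹ * omega (2 ^ n) ^ (t * k) := by
      -- Multiplying by `ω^k` completes the exponent `(4t - 1)k` to `4tk` plus a multiple of the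
      -- period, with no subtraction in `ℕ`.
      rw [eq_inv_mul_iff_mul_eq₀ (pow_ne_zero _ (omega_ne_zero _)), ← pow_add,
        show k + (4 * t + (2 ^ (n + 2) - 1)) * k = 4 * (t * k) + 2 ^ (n + 2) * k by
          obtain ⟨m, hm⟩ := Nat.exists_eq_add_of_le' (show 1 ≤ 2 ^ (n + 2) from Nat.one_le_two_pow)
          rw [hm, Nat.add_sub_cancel]; ring,
        pow_add, pow_mul, pow_mul _ (2 ^ (n + 2)), omega_pow_self, omega_pow_four, one_pow, mul_one]
    rw [this]
    ring

/-! ### Correctness of the twiddle procedures -/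

/-- The factor by which the output `k` of a procedure is divided. -/
def Proc.denom (n k : ℕ) : Proc → ℝ
  | .TW => 1
  | .TWS => scale n k
  | .TWS2 => scale (n + 1) k
  | .TWS4 => scale (n + 2) k

/-- The factor applied by `scaleMid`. -/
def Proc.midFactor (c : ℝ) : Proc → ℝ
  | .TWS2 => c
  | _ => 1

/-- The factor applied by `scaleEnd`. -/
def Proc.endFactor (c : ℝ) : Proc → ℝ
  | .TWS4 => c
  | _ => 1

/-- The real factor of the twiddle factor. -/
def Proc.twiddleScale (n k : ℕ) : Proc → ℝ
  | .TW => scale n k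
  | _ => scale n k / scale (n + 2) k

theorem toC_scaleMid (p : Proc) (c : ℝ) (x : ℝ × ℝ) :
    toC (p.scaleMid c x).eval = p.midFactor c * toC x := by
  cases p <;> simp [Proc.scaleMid, Proc.midFactor]

theorem toC_scaleEnd (p : Proc) (c : ℝ) (x : ℝ × ℝ) :
    toC (p.scaleEnd c x).eval = p.endFactor c * toC x := by
  cases p <;> simp [Proc.scaleEnd, Proc.endFactor]

theorem eval_rLin (r u q v : ℝ) : (rLin r u q v).eval = r * u + q * v := by
  rw [rLin]
  split_ifs with h h'
  · simp [rSmul, eval, h]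
  · simp [rSmul, eval, h']
  · simp [rSmul, rAdd, eval]

theorem twiddle_re (p : Proc) (n k : ℕ) :
    (p.twiddle n k).re = Real.cos (angle (n + 2) k) * p.twiddleScale n k := by
  cases p <;> simp only [Proc.twiddle, Proc.twiddleScale, Complex.re_mul_ofReal, omega_pow_eq] <;>
    simp [-Complex.ofReal_cos, -Complex.ofReal_sin]

theorem twiddle_im (p : Proc) (n k : ℕ) :
    (p.twiddle n k).im = -Real.sin (angle (n + 2) k) * p.twiddleScale n k := by
  cases p <;> simp only [Proc.twiddle, Proc.twiddleScale, Complex.im_mul_ofReal, omega_pow_eq] <;>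
    simp [-Complex.ofReal_cos, -Complex.ofReal_sin]

theorem toC_loopBody (p : Proc) (n k : ℕ) (a z b c : ℝ × ℝ) (j : Fin 4) :
    toC ((loopBody p n k a z b c).eval j) =
      p.endFactor (scale (n + 2) k / scale (n + 4) (k + j * 2 ^ n)) *
        ![toC a + p.midFactor (scale (n + 2) k / scale (n + 3) k) *
            ((p.twiddle n k).re * toC b + (p.twiddle n k).im * Complex.I * toC c),
          toC z + p.midFactor (scale (n + 2) k / scale (n + 3) (k + 2 ^ n)) *
            ((p.twiddle n k).im * toC b - (p.twiddle n k).re * Complex.I * toC c),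
          toC a - p.midFactor (scale (n + 2) k / scale (n + 3) k) *
            ((p.twiddle n k).re * toC b + (p.twiddle n k).im * Complex.I * toC c),
          toC z - p.midFactor (scale (n + 2) k / scale (n + 3) (k + 2 ^ n)) *
            ((p.twiddle n k).im * toC b - (p.twiddle n k).re * Complex.I * toC c)] j := by
  have e1 (r r' : ℝ) : toC (r * b.1 + r' * (-1 * c.2), r * b.2 + r' * c.1) =
      r * toC b + r' * Complex.I * toC c := by
    apply Complex.ext <;> simp [toC]
  have e2 (r r' : ℝ) : toC (r' * b.1 + r * c.2, r' * b.2 + r * (-1 * c.1)) =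
      r' * toC b - r * Complex.I * toC c := by
    apply Complex.ext <;> simp [toC]; ring
  simp only [loopBody, eval_bind, eval_forEach, toC_scaleEnd, ← e1, ← e2]
  congr 1
  fin_cases j <;> simp [toC_scaleMid, eval_rLin, rSmul, eval]

/-- The butterfly takes sum and difference as its inputs: the real part of the twiddle factor
multiplies `Z + Z'`, and its imaginary part times `i` multiplies `Z - Z'`. -/
theorem twiddle_combination (p : Proc) (n k : ℕ) (Z Z' : ℂ) :
    (p.twiddle n k).re * (Z + Z') + (p.twiddle n k).im * Complex.I * (Z - Z') =
      p.twiddleScale n k *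
        (omega (2 ^ (n + 2)) ^ k * Z + (omega (2 ^ (n + 2)) ^ k)⁻¹ * Z') := by
  rw [twiddle_re, twiddle_im, omega_pow_inv, omega_pow_eq]
  push_cast
  ring

theorem twiddle_combination' (p : Proc) (n k : ℕ) (Z Z' : ℂ) :
    (p.twiddle n k).im * (Z + Z') - (p.twiddle n k).re * Complex.I * (Z - Z') =
      p.twiddleScale n k * (omega (2 ^ (n + 2)) ^ (k + 2 ^ n) * Z +
        (omega (2 ^ (n + 2)) ^ (k + 2 ^ n))⁻¹ * Z') := by
  rw [omega_pow_add, mul_inv, inv_neg, Complex.inv_I, neg_neg, twiddle_re, twiddle_im,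
    omega_pow_inv, omega_pow_eq]
  push_cast
  linear_combination (-Complex.sin (angle (n + 2) k) * (Z + Z') * p.twiddleScale n k) *
    Complex.I_sq

/-- The divisibility makes wrapping around in the short vector agree with wrapping around in the
long one, so no bound on `i` is needed. -/
theorem seq_stride {n m : ℕ} (x : CVec ℝ n) {a : ℕ} (h : 2 ^ n ∣ a * 2 ^ m) (b i : ℕ) :
    seq (n := m) (fun j => CVec.get x (a * j + b)) i = seq x (a * i + b) := by
  have hlt : i % 2 ^ m < 2 ^ m := Nat.mod_lt _ (by positivity)
  rw [← seq_mod, seq_subvector x (fun j => a * j + b) hlt, ← seq_mod x, ← seq_mod x (a * i + b)]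
  congr 1
  refine Nat.ModEq.add_right b ((Nat.modEq_iff_dvd' (Nat.mul_le_mul_left a (Nat.mod_le i _))).2 ?_)
  refine h.trans ?_
  rw [← Nat.mul_sub]
  exact Nat.mul_dvd_mul_left a (Nat.dvd_sub_mod i)

theorem seq_periodic {n : ℕ} (x : CVec ℝ n) : Function.Periodic (seq x) (2 ^ n) := fun i => by
  rw [← seq_mod, Nat.add_mod_right, seq_mod]

theorem periodic_stride {n m : ℕ} {f : ℕ → ℂ} (hf : Function.Periodic f (2 ^ n)) {a : ℕ}
    (h : a * 2 ^ m = 2 ^ n) (b : ℕ) : Function.Periodic (fun j => f (a * j + b)) (2 ^ m) :=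
  fun j => by simp only [mul_add, h, add_right_comm _ _ b, hf _]

theorem scale_ne_zero (n k : ℕ) : scale n k ≠ 0 := (scale_pos n k).ne'

theorem scale_add_two_mul_pow (n k : ℕ) : scale (n + 3) (k + 2 * 2 ^ n) = scale (n + 3) k := by
  rw [← pow_succ']; exact scale_add_pow (n + 1) k

theorem scale_shift (n k j : ℕ) : scale (n + 2) (k + j * 2 ^ n) = scale (n + 2) k := by
  rw [← scale_mod, Nat.add_mul_mod_self_right, scale_mod]

theorem scale_shift_mod_two (n k : ℕ) (j : Fin 4) :
    scale (n + 3) (k + j * 2 ^ n) = scale (n + 3) (k + j % 2 * 2 ^ n) := by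
  fin_cases j
  · rfl
  · rfl
  · simpa using scale_add_two_mul_pow n k
  · have := scale_add_two_mul_pow n (k + 2 ^ n)
    simp only [show k + 2 ^ n + 2 * 2 ^ n = k + 3 * 2 ^ n by ring] at this
    simpa using this

/-- Denominators agree along the even branch. Only `j % 2` matters on the input side because that
transform has length `N/2`; for `TWS2` this matches the period `N/2` of `s_{2N,·}`. -/
theorem endFactor_div_denom (p : Proc) (n k : ℕ) (j : Fin 4) :
    p.endFactor (scale (n + 2) k / scale (n + 4) (k + j * 2 ^ n)) /
      p.even.denom (n + 1) (k + j % 2 * 2 ^ n) = 1 / p.denom (n + 2) (k + j * 2 ^ n) := by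
  have h1 := scale_ne_zero (n + 2) k
  cases p
  · simp [Proc.endFactor, Proc.denom, Proc.even]
  · simp [Proc.endFactor, Proc.denom, Proc.even, scale_shift]
  · simp [Proc.endFactor, Proc.denom, Proc.even, scale_shift_mod_two]
  · simp only [Proc.endFactor, Proc.denom, Proc.even, scale_shift]
    field_simp

/-- Denominators agree along the odd branches, whose `TWS` outputs arrive divided by `s_{N/4,k}`. -/
theorem endFactor_mul_midFactor (p : Proc) (n k : ℕ) (j : Fin 4) :
    p.endFactor (scale (n + 2) k / scale (n + 4) (k + j * 2 ^ n)) *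
      p.midFactor (scale (n + 2) k / scale (n + 3) (k + j % 2 * 2 ^ n)) *
      (p.twiddleScale n k / scale n k) = 1 / p.denom (n + 2) (k + j * 2 ^ n) := by
  have h0 := scale_ne_zero n k
  have h1 := scale_ne_zero (n + 2) k
  cases p
  · simp [Proc.endFactor, Proc.denom, Proc.midFactor, Proc.twiddleScale, h0]
  · simp only [Proc.endFactor, Proc.denom, Proc.midFactor, Proc.twiddleScale, scale_shift]
    field_simp
  · simp only [Proc.endFactor, Proc.denom, Proc.midFactor, Proc.twiddleScale, scale_shift_mod_two]
    field_simp
  · simp only [Proc.endFactor, Proc.denom, Proc.midFactor, Proc.twiddleScale]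
    field_simp

/-- One iteration of the loop combines the three shorter transforms. -/
theorem loop_identity (p : Proc) (n : ℕ) {f : ℕ → ℂ} (hf : Function.Periodic f (2 ^ (n + 2)))
    (k : ℕ) (j : Fin 4) :
    (p.endFactor (scale (n + 2) k / scale (n + 4) (k + j * 2 ^ n)) : ℂ) *
      ![dft (n + 1) (fun t => f (2 * t)) k / p.even.denom (n + 1) k +
          p.midFactor (scale (n + 2) k / scale (n + 3) k) * ((p.twiddle n k).re *
            ((dft n (fun t => f (4 * t + 1)) k + dft n (fun t => f (4 * t + (2 ^ (n + 2) - 1))) k) /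
              Proc.TWS.denom n k) + (p.twiddle n k).im * Complex.I *
            ((dft n (fun t => f (4 * t + 1)) k - dft n (fun t => f (4 * t + (2 ^ (n + 2) - 1))) k) /
              Proc.TWS.denom n k)),
        dft (n + 1) (fun t => f (2 * t)) (k + 2 ^ n) / p.even.denom (n + 1) (k + 2 ^ n) +
          p.midFactor (scale (n + 2) k / scale (n + 3) (k + 2 ^ n)) * ((p.twiddle n k).im *
            ((dft n (fun t => f (4 * t + 1)) k + dft n (fun t => f (4 * t + (2 ^ (n + 2) - 1))) k) /
              Proc.TWS.denom n k) - (p.twiddle n k).re * Complex.I *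
            ((dft n (fun t => f (4 * t + 1)) k - dft n (fun t => f (4 * t + (2 ^ (n + 2) - 1))) k) /
              Proc.TWS.denom n k)),
        dft (n + 1) (fun t => f (2 * t)) k / p.even.denom (n + 1) k -
          p.midFactor (scale (n + 2) k / scale (n + 3) k) * ((p.twiddle n k).re *
            ((dft n (fun t => f (4 * t + 1)) k + dft n (fun t => f (4 * t + (2 ^ (n + 2) - 1))) k) /
              Proc.TWS.denom n k) + (p.twiddle n k).im * Complex.I *
            ((dft n (fun t => f (4 * t + 1)) k - dft n (fun t => f (4 * t + (2 ^ (n + 2) - 1))) k) /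
              Proc.TWS.denom n k)),
        dft (n + 1) (fun t => f (2 * t)) (k + 2 ^ n) / p.even.denom (n + 1) (k + 2 ^ n) -
          p.midFactor (scale (n + 2) k / scale (n + 3) (k + 2 ^ n)) * ((p.twiddle n k).im *
            ((dft n (fun t => f (4 * t + 1)) k + dft n (fun t => f (4 * t + (2 ^ (n + 2) - 1))) k) /
              Proc.TWS.denom n k) - (p.twiddle n k).re * Complex.I *
            ((dft n (fun t => f (4 * t + 1)) k - dft n (fun t => f (4 * t + (2 ^ (n + 2) - 1))) k) /
              Proc.TWS.denom n k))] j =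
      dft (n + 2) f (k + j * 2 ^ n) / p.denom (n + 2) (k + j * 2 ^ n) := by
  have d0 := dft_splitRadix n hf k
  have d1 := dft_splitRadix n hf (k + 2 ^ n)
  have d2 := dft_splitRadix n hf (k + 2 ^ n + 2 ^ n)
  have d3 := dft_splitRadix n hf (k + 2 ^ n + 2 ^ n + 2 ^ n)
  have hA (k : ℕ) : dft (n + 1) (fun t => f (2 * t)) (k + 2 ^ n + 2 ^ n) =
      dft (n + 1) (fun t => f (2 * t)) k := by
    rw [add_assoc, ← two_mul, ← pow_succ']; exact dft_add_pow _ _ _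
  -- Half a turn changes only the sign of the odd part, so the outputs `k + N/2` and `k + 3N/4`
  -- reuse the products of `k` and `k + N/4`.
  have hw (k : ℕ) : omega (2 ^ (n + 2)) ^ (k + 2 ^ n + 2 ^ n) = -omega (2 ^ (n + 2)) ^ k := by
    rw [omega_pow_add, omega_pow_add]
    linear_combination (omega (2 ^ (n + 2)) ^ k) * Complex.I_sq
  simp only [dft_add_pow, hA, hw, inv_neg] at d1 d2 d3
  rw [show k + 2 ^ n + 2 ^ n = k + 2 * 2 ^ n by ring] at d2
  rw [show k + 2 ^ n + 2 ^ n + 2 ^ n = k + 3 * 2 ^ n by ring] at d3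
  generalize dft n (fun t => f (4 * t + 1)) k = Z at *
  generalize dft n (fun t => f (4 * t + (2 ^ (n + 2) - 1))) k = Z' at *
  generalize dft (n + 1) (fun t => f (2 * t)) k = A at *
  generalize dft (n + 1) (fun t => f (2 * t)) (k + 2 ^ n) = A' at *
  have t0 := twiddle_combination p n k Z Z'
  have t1 := twiddle_combination' p n k Z Z'
  have e1 := congrArg (fun r : ℝ => (r : ℂ)) (endFactor_div_denom p n k j)
  have e2 := congrArg (fun r : ℝ => (r : ℂ)) (endFactor_mul_midFactor p n k j)
  simp only [Complex.ofReal_mul, Complex.ofReal_div, Complex.ofReal_one] at e1 e2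
  change _ = dft (n + 2) f (k + j * 2 ^ n) / (p.denom (n + 2) (k + j * 2 ^ n) : ℂ)
  rw [div_eq_mul_one_div (dft _ _ _)]
  have hden : Proc.TWS.denom n k = scale n k := rfl
  rw [hden]
  generalize (omega (2 ^ (n + 2)) ^ k)⁻¹ = v at *
  generalize omega (2 ^ (n + 2)) ^ k = u at *
  generalize (omega (2 ^ (n + 2)) ^ (k + 2 ^ n))⁻¹ = v' at *
  generalize omega (2 ^ (n + 2)) ^ (k + 2 ^ n) = u' at *
  fin_cases j <;> simp at e1 e2 ⊢
  · rw [d0]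
    linear_combination A * e1 + (u * Z + v * Z') * e2 +
      p.endFactor (scale (n + 2) k / scale (n + 4) k) *
        p.midFactor (scale (n + 2) k / scale (n + 3) k) / (scale n k : ℂ) * t0
  · rw [d1]
    linear_combination A' * e1 + (u' * Z + v' * Z') * e2 +
      p.endFactor (scale (n + 2) k / scale (n + 4) (k + 2 ^ n)) *
        p.midFactor (scale (n + 2) k / scale (n + 3) (k + 2 ^ n)) / (scale n k : ℂ) * t1
  · rw [d2]
    linear_combination A * e1 - (u * Z + v * Z') * e2 -
      p.endFactor (scale (n + 2) k / scale (n + 4) (k + 2 * 2 ^ n)) *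
        p.midFactor (scale (n + 2) k / scale (n + 3) k) / (scale n k : ℂ) * t0
  · rw [d3]
    linear_combination A' * e1 - (u' * Z + v' * Z') * e2 -
      p.endFactor (scale (n + 2) k / scale (n + 4) (k + 3 * 2 ^ n)) *
        p.midFactor (scale (n + 2) k / scale (n + 3) (k + 2 ^ n)) / (scale n k : ℂ) * t1

/-- The twiddle procedures turn a transformed vector into a rescaled Fourier transform. -/
theorem toC_tw : ∀ (n : ℕ) (p : Proc) (f : ℕ → ℂ) (y : CVec ℝ n),
    Function.Periodic f (2 ^ n) → IsUprooted n f (seq y) → ∀ i : Fin (2 ^ n),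
    toC ((tw n p y).eval i) = dft n f i / p.denom n i
  | 0, p, f, y, hf, h, i => by
    have h0 := h _ (List.mem_singleton_self _) 0
    obtain rfl : i = 0 := Fin.ext (Nat.lt_one_iff.1 i.2)
    have hp : p.denom 0 0 = 1 := by cases p <;> rfl
    simp [splitRadixIndex, hadamard, walsh] at h0
    simp [tw, dft, hp, ← h0, seq, CVec.get]
  | 1, p, f, y, hf, h, i => by
    have h0 : seq y 0 = f 0 := by
      simpa [splitRadixIndex, hadamard, walsh] using h ⟨0, fun _ => 0⟩ (by simp [partition]) 0
    have h1 : seq y 1 = f 1 := by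
      simpa [splitRadixIndex, hadamard, walsh] using h ⟨0, fun _ => 1⟩ (by simp [partition]) 0
    have hw : omega 2 = -1 := by
      rw [omega, ← Complex.exp_neg_pi_mul_I]
      congr 1
      push_cast
      ring
    have hy0 : toC (y 0) = f 0 := by rw [← h0]; exact (seq_val y 0).symm
    have hy1 : toC (y 1) = f 1 := by rw [← h1]; exact (seq_val y 1).symm
    have hp : p.denom 1 0 = 1 := by cases p <;> simp [Proc.denom, scale_zero_right]
    have hp1 : (p.endFactor (1 / scale 3 1) : ℝ) = 1 / p.denom 1 1 := by
      cases p <;> simp [Proc.denom, Proc.endFactor, scale]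
    simp only [tw, eval_bind, pure_eq_ret, eval_ret]
    change Fin 2 at i
    fin_cases i
    · simp [dft, hp, Finset.sum_range_succ, hy0, hy1]
    · simp [dft, Finset.sum_range_succ, hy0, hy1, toC_scaleEnd, hw, hp1, -one_div]
      ring
  | n + 2, p, f, y, hf, h, i => by
    have h2 : 2 * 2 ^ (n + 1) = 2 ^ (n + 2) := by ring
    have h4 : 4 * 2 ^ n = 2 ^ (n + 2) := by ring
    have ihA := toC_tw (n + 1) p.even (fun t => f (2 * t)) (fun j => CVec.get y (2 * j))
      (periodic_stride hf h2 0) (by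
        have : seq (n := n + 1) (fun j => CVec.get y (2 * j)) = fun i => seq y (2 * i) :=
          funext fun i => seq_stride y h2.symm.dvd 0 i
        rw [this]; exact h.even)
    have ihB := toC_tw n .TWS _ (fun j => CVec.get y (4 * j + 1))
      ((periodic_stride hf h4 1).add (periodic_stride hf h4 (2 ^ (n + 2) - 1))) (by
        have : seq (n := n) (fun j => CVec.get y (4 * j + 1)) = fun i => seq y (4 * i + 1) :=
          funext fun i => seq_stride y h4.symm.dvd 1 i
        rw [this]; exact (h.odd hf (seq_periodic y)).1)
    have ihC := toC_tw n .TWS _ (fun j => CVec.get y (4 * j + (2 ^ (n + 2) - 1)))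
      ((periodic_stride hf h4 1).sub (periodic_stride hf h4 (2 ^ (n + 2) - 1))) (by
        have : seq (n := n) (fun j => CVec.get y (4 * j + (2 ^ (n + 2) - 1))) =
            fun i => seq y (4 * i + (2 ^ (n + 2) - 1)) :=
          funext fun i => seq_stride y h4.symm.dvd _ i
        rw [this]; exact (h.odd hf (seq_periodic y)).2)
    have hj : (i : ℕ) / 2 ^ n < 4 := Nat.div_lt_of_lt_mul
      (by rw [mul_comm, h4]; exact i.2)
    obtain ⟨j, hj⟩ : ∃ j : Fin 4, (j : ℕ) = i / 2 ^ n := ⟨⟨_, hj⟩, rfl⟩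
    have hj' : Fin.ofNat 4 ((i : ℕ) / 2 ^ n) = j := by rw [← hj]; simp
    simp only [tw, eval_bind, pure_eq_ret, eval_ret, eval_forEach, hj', toC_loopBody]
    have hi : (i : ℕ) = (Fin.ofNat (2 ^ n) (i : ℕ) : Fin (2 ^ n)) + j * 2 ^ n := by
      rw [hj]; exact (val_eq_block i).trans (add_comm _ _)
    generalize Fin.ofNat (2 ^ n) (i : ℕ) = k at *
    rw [hi]
    have hk := k.2
    have hA0 : toC (CVec.get (tw (n + 1) p.even fun j => CVec.get y (2 * j)).eval k) = _ :=
      (seq_of_lt _ (by omega)).trans (ihA ⟨k, by omega⟩)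
    have hA1 : toC (CVec.get (tw (n + 1) p.even fun j => CVec.get y (2 * j)).eval
        (k + 2 ^ n)) = _ :=
      (seq_of_lt _ (by omega)).trans (ihA ⟨k + 2 ^ n, by omega⟩)
    rw [hA0, hA1, ihB, ihC]
    simp only [Pi.add_def, Pi.sub_def, dft_add, dft_sub]
    exact loop_identity p n hf k j

/-- The algorithm computes the discrete Fourier transform. -/
theorem whufftOutput_eq (n : ℕ) (x : Fin (2 ^ n) → ℂ) :
    whufftOutput n x = dftMatrix (2 ^ n) *ᵥ x := by
  funext k
  have h := toC_tw n .TW _ _ (seq_periodic _)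
    (isUprooted_hPrime n fun j => ((x j).re, (x j).im)) k
  have e : whufftOutput n x k =
      toC ((tw n .TW (hPrime n fun j => ((x j).re, (x j).im)).eval).eval k) := by
    simp only [whufftOutput, whufftRun, whufft, eval_bind, toC]
  rw [e, h, dft, Finset.sum_range, Matrix.mulVec, dotProduct]
  simp only [Proc.denom, Complex.ofReal_one, div_one, seq_val, dftMatrix, Matrix.of_apply]
  refine Finset.sum_congr rfl fun t _ => ?_
  rw [mul_comm (t : ℕ)]
  rfl

/-! ### Distinct scale factors -/

/-- The half-angle formulas give `(1 ± cos 2θ)/2` for the two squares, and the maximum takes the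
absolute value. Thus a field contains the square of `amp θ` exactly when it contains `cos 2θ`. -/
theorem amp_sq (θ : ℝ) : amp θ ^ 2 = (1 + |Real.cos (2 * θ)|) / 2 := by
  have h1 := Real.cos_two_mul θ
  have h2 := Real.cos_two_mul' θ
  have hs := sq_abs (Real.sin θ)
  have hc := sq_abs (Real.cos θ)
  have h3 := Real.sin_sq_add_cos_sq θ
  rw [amp]
  rcases le_total |Real.cos θ| |Real.sin θ| with h | h
  · rw [max_eq_right h, sq_abs, abs_of_nonpos (a := Real.cos (2 * θ))
      (by nlinarith [abs_nonneg (Real.cos θ)])]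
    linarith
  · rw [max_eq_left h, sq_abs, abs_of_nonneg (a := Real.cos (2 * θ))
      (by nlinarith [abs_nonneg (Real.sin θ)])]
    linarith

theorem ofReal_abs_mem {K : IntermediateField ℚ ℂ} {r : ℝ} : ((|r| : ℝ) : ℂ) ∈ K ↔ (r : ℂ) ∈ K := by
  rcases abs_choice r with h | h <;> simp [h]

theorem angle_eq_four_mul (n k : ℕ) : angle n k = 4 * angle (n + 2) k := by
  rw [angle, angle, pow_add]
  field_simp
  ring

theorem angle_succ (n k : ℕ) : angle n k = 2 * angle (n + 1) k := by
  rw [angle, angle, pow_add]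
  field_simp

theorem cos_four_mul_mem {K : IntermediateField ℚ ℂ} {θ : ℝ} (h : (Real.cos θ : ℂ) ∈ K) :
    (Real.cos (4 * θ) : ℂ) ∈ K := by
  have h1 : (1 : ℂ) ∈ K := K.one_mem
  have h2 : (2 : ℂ) ∈ K := by exact_mod_cast K.natCast_mem 2
  have step {x : ℝ} (h : (Real.cos x : ℂ) ∈ K) : (Real.cos (2 * x) : ℂ) ∈ K := by
    rw [Real.cos_two_mul]
    push_cast at h ⊢
    exact K.sub_mem (K.mul_mem h2 (pow_mem h 2)) h1
  rw [show 4 * θ = 2 * (2 * θ) by ring]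
  exact step (step h)

theorem amp_sq_mem {K : IntermediateField ℚ ℂ} {θ : ℝ} :
    ((amp θ ^ 2 : ℝ) : ℂ) ∈ K ↔ (Real.cos (2 * θ) : ℂ) ∈ K := by
  have h1 : (1 : ℂ) ∈ K := K.one_mem
  have h2 : (2 : ℂ) ∈ K := by exact_mod_cast K.natCast_mem 2
  rw [amp_sq, ← ofReal_abs_mem (r := Real.cos (2 * θ))]
  constructor
  · intro h
    have := K.sub_mem (K.mul_mem h2 h) h1
    convert this using 1
    push_cast
    ring
  · intro h
    have := K.div_mem (K.add_mem h1 h) h2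
    exact_mod_cast this

/-- Each earlier angle in the product is four times the next one, so the cosine belonging to the
last factor generates all the others by duplication. -/
theorem scale_sq_mem {K : IntermediateField ℚ ℂ} : ∀ (n k : ℕ),
    (Real.cos (2 * angle n k) : ℂ) ∈ K → ((scale n k ^ 2 : ℝ) : ℂ) ∈ K
  | 0, k, _ => by simp [scale]
  | 1, k, _ => by simp [scale]
  | n + 2, k, h => by
    rw [scale_add_two, mul_pow, Complex.ofReal_mul]
    refine K.mul_mem (scale_sq_mem n k ?_) (amp_sq_mem.2 h)
    rw [angle_eq_four_mul, mul_left_comm]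
    exact cos_four_mul_mem h

/-- Squaring halves the order, and with it the degree `φ(2^(m+1)) = 2^m` of the cyclotomic field. -/
theorem notMem_adjoin_sq {ξ : ℂ} {b : ℕ} (h : IsPrimitiveRoot ξ (2 ^ (b + 2))) :
    ξ ∉ IntermediateField.adjoin ℚ {ξ ^ 2} := by
  intro hmem
  have deg (m : ℕ) (ζ : ℂ) (hζ : IsPrimitiveRoot ζ (2 ^ (m + 1))) :
      IsIntegral ℚ ζ ∧ Module.finrank ℚ (IntermediateField.adjoin ℚ {ζ}) = 2 ^ m := by
    have hi : IsIntegral ℚ ζ := (hζ.isIntegral (by positivity)).tower_top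
    refine ⟨hi, ?_⟩
    rw [IntermediateField.adjoin.finrank hi,
      ← Polynomial.cyclotomic_eq_minpoly_rat hζ (by positivity), Polynomial.natDegree_cyclotomic,
      Nat.totient_prime_pow_succ Nat.prime_two]
    simp
  have h1 := (deg (b + 1) ξ h).2
  have h2 := (deg b (ξ ^ 2) (h.pow (by positivity) (by ring))).2
  have heq : IntermediateField.adjoin ℚ {ξ} = IntermediateField.adjoin ℚ {ξ ^ 2} :=
    le_antisymm (IntermediateField.adjoin_simple_le_iff.2 hmem)
      (IntermediateField.adjoin_simple_le_iff.2
        (pow_mem (IntermediateField.mem_adjoin_simple_self ℚ ξ) 2))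
  rw [heq, h2, pow_succ] at h1
  have : 0 < 2 ^ b := by positivity
  omega

theorem exists_isPrimitiveRoot {n k : ℕ} (hk : ¬ 2 ^ n ∣ k) :
    ∃ b : ℕ, IsPrimitiveRoot (Complex.exp (angle (n + 2) k * Complex.I)) (2 ^ (b + 3)) := by
  have hk0 : k ≠ 0 := fun h => hk (h ▸ dvd_zero _)
  obtain ⟨a, q, hq, rfl⟩ := Nat.exists_eq_two_pow_mul_odd hk0
  have ha : a < n := by
    by_contra! h
    exact hk ((pow_dvd_pow 2 h).mul_right q)
  obtain ⟨b, rfl⟩ := Nat.exists_eq_add_of_lt ha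
  refine ⟨b, ?_⟩
  have := Complex.isPrimitiveRoot_exp_of_coprime q (2 ^ (b + 3)) (by positivity)
    (Nat.Coprime.pow_right _ (Nat.coprime_two_right.2 hq))
  convert this using 2
  rw [angle, show a + b + 1 + 2 = a + (b + 3) by ring, pow_add]
  push_cast
  field_simp

/-- Put `ξ = e^{iφ}` with `φ = 2πk/2^(n+2)`. The squares of `scale (n + 2) k` and `scale (n + 1) k`
lie in `ℚ(ξ²)`. Equality would put their quotient `(1 + |cos φ|)/2`, hence `cos φ`, and hence `ξ`,
into that field, contradicting `notMem_adjoin_sq`. -/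
theorem scale_ne_scale_succ {n k : ℕ} (hk : ¬ 2 ^ n ∣ k) : scale (n + 2) k ≠ scale (n + 3) k := by
  intro heq
  obtain ⟨b, hb⟩ := exists_isPrimitiveRoot hk
  set φ := angle (n + 2) k with hφ
  set ξ := Complex.exp (φ * Complex.I) with hξ
  have hξ0 : ξ ≠ 0 := Complex.exp_ne_zero _
  set K := IntermediateField.adjoin ℚ {ξ ^ 2} with hK
  have h2 : (2 : ℂ) ∈ K := by exact_mod_cast K.natCast_mem 2
  have hsq : ξ ^ 2 ∈ K := IntermediateField.mem_adjoin_simple_self ℚ (ξ ^ 2)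
  have cosφ : (Real.cos φ : ℂ) = (ξ + ξ⁻¹) / 2 := by
    rw [Complex.ofReal_cos, Complex.cos, hξ, ← Complex.exp_neg, neg_mul]
  have cos2φ : (Real.cos (2 * φ) : ℂ) = (ξ ^ 2 + (ξ ^ 2)⁻¹) / 2 := by
    rw [Complex.ofReal_cos, Complex.cos, hξ, ← Complex.exp_nat_mul, ← Complex.exp_neg]
    push_cast
    ring_nf
  have hc2 : (Real.cos (2 * φ) : ℂ) ∈ K := by
    rw [cos2φ]; exact K.div_mem (K.add_mem hsq (K.inv_mem hsq)) h2
  have hs2 : ((scale (n + 2) k ^ 2 : ℝ) : ℂ) ∈ K := scale_sq_mem (n + 2) k hc2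
  have hs1 : ((scale (n + 1) k ^ 2 : ℝ) : ℂ) ∈ K := by
    refine scale_sq_mem (n + 1) k ?_
    rw [angle_succ (n + 1), ← hφ]
    have h2 : (Real.cos (2 * (2 * φ)) : ℂ) = 2 * (Real.cos (2 * φ) : ℂ) ^ 2 - 1 := by
      rw [Real.cos_two_mul (2 * φ)]; push_cast; rfl
    rw [h2]
    exact K.sub_mem (K.mul_mem ‹_› (pow_mem hc2 2)) K.one_mem
  have hamp : ((amp (angle (n + 3) k) ^ 2 : ℝ) : ℂ) ∈ K := by
    have : amp (angle (n + 3) k) ^ 2 = scale (n + 2) k ^ 2 / scale (n + 1) k ^ 2 := by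
      rw [heq, scale_add_two (n + 1), mul_pow, mul_div_cancel_left₀]
      exact pow_ne_zero _ (scale_ne_zero _ _)
    rw [this, Complex.ofReal_div]
    exact K.div_mem hs2 hs1
  have hc : (Real.cos φ : ℂ) ∈ K := by
    rw [hφ, angle_succ (n + 2)]; exact amp_sq_mem.1 hamp
  -- The order of `ξ` is at least 8, so `ξ ^ 4 ≠ 1`; this makes `cos φ` nonzero for the division
  -- below.
  have hne : 1 + ξ ^ 2 ≠ 0 := by
    intro h0
    have h4 : ξ ^ 4 = 1 := by linear_combination (ξ ^ 2 - 1) * h0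
    have := Nat.le_of_dvd (by norm_num) (hb.dvd_of_pow_eq_one 4 h4)
    have : 0 < 2 ^ b := by positivity
    rw [pow_add] at *
    omega
  refine notMem_adjoin_sq hb ?_
  have : ξ = (1 + ξ ^ 2) / (2 * (Real.cos φ : ℂ)) := by
    rw [cosφ]
    have : ξ + ξ⁻¹ = (1 + ξ ^ 2) / ξ := by field_simp; ring
    rw [this]
    field_simp
  rw [← hK, this]
  exact K.div_mem (K.add_mem K.one_mem hsq) (K.mul_mem h2 hc)

theorem amp_pi_div_four_lt_one : amp (Real.pi / 4) < 1 := by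
  have hpi := Real.pi_pos
  rw [amp_eq_cos (by positivity) le_rfl, ← Real.cos_zero]
  exact Real.cos_lt_cos_of_nonneg_of_le_pi le_rfl (by linarith) (by linarith)

theorem scale_half_lt_one (n : ℕ) : scale (n + 3) (2 ^ n) < 1 := by
  rw [show n + 3 = n + 1 + 2 from rfl, scale_add_two]
  have : angle (n + 1 + 2) (2 ^ n) = Real.pi / 4 := by
    rw [angle, pow_add, pow_add]; push_cast; field_simp; norm_num
  rw [this]
  exact (mul_le_of_le_one_left (amp_pos _).le (scale_le_one _ _)).trans_lt amp_pi_div_four_lt_one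

/-! ### Costs of the twiddle procedures -/

/-- Multiplication by `c` is free. -/
def IsFree (c : ℝ) : Prop := c = 0 ∨ c = 1 ∨ c = -1

theorem not_isFree {c : ℝ} (h0 : 0 < |c|) (h1 : |c| < 1) : ¬ IsFree c := by
  rintro (rfl | rfl | rfl) <;> simp at h0 h1

theorem arith_rSmul_of_isFree {c : ℝ} (h : IsFree c) (u : ℝ) : (rSmul c u).arith = 0 := by
  rw [arith_rSmul]; exact if_pos h

theorem arith_rSmul_of_not_isFree {c : ℝ} (h : ¬ IsFree c) (u : ℝ) : (rSmul c u).arith = 1 := by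
  rw [arith_rSmul]; exact if_neg h

theorem arith_cSmul_of_isFree {c : ℝ} (h : IsFree c) (x : ℝ × ℝ) : (cSmul c x).arith = 0 := by
  rw [arith_cSmul]; exact if_pos h

theorem arith_cSmul_of_not_isFree {c : ℝ} (h : ¬ IsFree c) (x : ℝ × ℝ) :
    (cSmul c x).arith = 2 := by
  rw [arith_cSmul]; exact if_neg h

theorem isFree_one : IsFree 1 := .inr (.inl rfl)

theorem isFree_neg_one : IsFree (-1) := .inr (.inr rfl)

theorem arith_rLin_of_ne {r q : ℝ} (hr : r ≠ 0) (hq : q ≠ 0) (u v : ℝ) :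
    (rLin r u q v).arith = (rSmul r u).arith + (rSmul q v).arith + 1 := by
  rw [rLin, if_neg hr, if_neg hq, isCost_arith.bind, isCost_arith.bind, add_assoc]
  rfl

theorem arith_rLin_zero_right (r u v : ℝ) (hr : IsFree r) : (rLin r u 0 v).arith = 0 := by
  rw [rLin, if_pos rfl]
  split_ifs
  · exact arith_rSmul_of_isFree (.inl rfl) _
  · exact arith_rSmul_of_isFree hr _

theorem arith_rLin_zero_left (q u v : ℝ) (hq : IsFree q) : (rLin 0 u q v).arith = 0 := by
  rw [rLin, if_pos rfl]
  exact arith_rSmul_of_isFree hq _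

/-- The cost of each of the four linear combinations in iteration `k`. -/
def Proc.linCost (n k : ℕ) : Proc → ℕ
  | .TW => if k = 0 then 0 else 3
  | _ => if k = 0 then 0 else if 2 * k = 2 ^ n then 1 else 2

theorem angle_mem {n k : ℕ} (h0 : k ≠ 0) (hk : k < 2 ^ n) :
    0 < angle (n + 2) k ∧ angle (n + 2) k < Real.pi / 2 ∧
      (angle (n + 2) k < Real.pi / 4 ↔ 2 * k < 2 ^ n) ∧
      (angle (n + 2) k = Real.pi / 4 ↔ 2 * k = 2 ^ n) := by
  have hpi := Real.pi_pos
  have hp : (0 : ℝ) < 2 ^ n := by positivity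
  have e : angle (n + 2) k = Real.pi / 4 * (2 * k / 2 ^ n) := by
    rw [angle, pow_add]; field_simp; norm_num
  have hk' : (k : ℝ) < 2 ^ n := by exact_mod_cast hk
  have h4 : 0 < Real.pi / 4 := by positivity
  refine ⟨?_, ?_, ?_, ?_⟩
  · have : 0 < (k : ℝ) := by exact_mod_cast Nat.pos_of_ne_zero h0
    rw [e]; positivity
  · rw [e, show Real.pi / 2 = Real.pi / 4 * 2 by ring, mul_lt_mul_iff_right₀ h4, div_lt_iff₀ hp]
    linarith
  · rw [e, mul_lt_iff_lt_one_right h4, div_lt_one hp]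
    exact_mod_cast Iff.rfl
  · rw [e, mul_eq_left₀ h4.ne', div_eq_one_iff_eq hp.ne']
    exact_mod_cast Iff.rfl

theorem twiddleScale_eq_inv_amp (p : Proc) (hp : p ≠ .TW) (n k : ℕ) :
    p.twiddleScale n k = (amp (angle (n + 2) k))⁻¹ := by
  have h : scale n k / scale (n + 2) k = (amp (angle (n + 2) k))⁻¹ := by
    rw [scale_add_two, div_mul_cancel_left₀ (scale_ne_zero n k)]
  cases p
  · exact absurd rfl hp
  all_goals exact h

theorem cost_pair_of_TW {n k : ℕ} (h0 : k ≠ 0) (hk : k < 2 ^ n) :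
    ¬ IsFree (Proc.TW.twiddle n k).re ∧ ¬ IsFree (Proc.TW.twiddle n k).im := by
  obtain ⟨hpos, hlt, -, -⟩ := angle_mem h0 hk
  have hpi := Real.pi_pos
  have hc : 0 < Real.cos (angle (n + 2) k) :=
    Real.cos_pos_of_mem_Ioo ⟨by linarith, by linarith⟩
  have hs : 0 < Real.sin (angle (n + 2) k) := Real.sin_pos_of_pos_of_lt_pi hpos (by linarith)
  have h1 := Real.sin_sq_add_cos_sq (angle (n + 2) k)
  have hsc := scale_pos n k
  have hsc' := scale_le_one n k
  rw [twiddle_re, twiddle_im, neg_mul]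
  simp only [Proc.twiddleScale]
  constructor <;> refine not_isFree ?_ ?_
  · positivity
  · rw [abs_of_pos (by positivity)]
    exact (mul_le_of_le_one_right hc.le hsc').trans_lt (by nlinarith)
  · rw [abs_neg]; positivity
  · rw [abs_neg, abs_of_pos (by positivity)]
    exact (mul_le_of_le_one_right hs.le hsc').trans_lt (by nlinarith)

open Classical in
-- Dividing by `amp` turns the larger of cosine and sine into `±1`. At angle `π/4` both become free;
-- elsewhere the other component lies strictly between 0 and 1 in absolute value.
theorem cost_pair (p : Proc) (hp : p ≠ .TW) {n k : ℕ} (h0 : k ≠ 0) (hk : k < 2 ^ n) :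
    (p.twiddle n k).re ≠ 0 ∧ (p.twiddle n k).im ≠ 0 ∧
    (if IsFree (p.twiddle n k).re then 0 else 1) + (if IsFree (p.twiddle n k).im then 0 else 1) =
      if 2 * k = 2 ^ n then 0 else 1 := by
  obtain ⟨hpos, hlt, hlt4, heq4⟩ := angle_mem h0 hk
  rw [twiddle_re, twiddle_im, twiddleScale_eq_inv_amp p hp, ← div_eq_mul_inv, ← div_eq_mul_inv]
  simp only [← heq4]
  generalize angle (n + 2) k = θ at *
  have hpi := Real.pi_pos
  have hc : 0 < Real.cos θ := Real.cos_pos_of_mem_Ioo ⟨by linarith, by linarith⟩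
  have hs : 0 < Real.sin θ := Real.sin_pos_of_pos_of_lt_pi hpos (by linarith)
  have ha := amp_pos θ
  refine ⟨by positivity, by rw [neg_div]; exact neg_ne_zero.2 (by positivity), ?_⟩
  rcases lt_trichotomy θ (Real.pi / 4) with h | h | h
  · have hsc : Real.sin θ < Real.cos θ := by
      rw [← Real.cos_pi_div_two_sub]
      exact Real.cos_lt_cos_of_nonneg_of_le_pi hpos.le (by linarith) (by linarith)
    rw [amp_eq_cos hpos.le h.le, div_self hc.ne', neg_div, if_pos isFree_one, if_neg h.ne,
      if_neg (not_isFree _ _)]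
    · rw [abs_neg]; positivity
    · rw [abs_neg, abs_of_pos (by positivity)]
      exact (div_lt_one hc).2 hsc
  · have hsc : Real.sin θ = Real.cos θ := by rw [h, Real.sin_pi_div_four, Real.cos_pi_div_four]
    rw [amp_eq_cos hpos.le h.le, hsc, div_self hc.ne', neg_div, div_self hc.ne', if_pos isFree_one,
      if_pos isFree_neg_one, if_pos h]
  · have hsc : Real.cos θ < Real.sin θ := by
      rw [← Real.cos_pi_div_two_sub]
      exact Real.cos_lt_cos_of_nonneg_of_le_pi (by linarith) (by linarith) (by linarith)
    rw [amp_eq_sin h.le hlt.le, neg_div, div_self hs.ne', if_pos isFree_neg_one, if_neg h.ne',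
      if_neg (not_isFree _ _)]
    · positivity
    · rw [abs_of_pos (by positivity)]
      exact (div_lt_one hs).2 hsc

theorem twiddle_zero (p : Proc) (n : ℕ) : p.twiddle n 0 = 1 := by
  cases p <;> simp [Proc.twiddle, scale_zero_right]

theorem arith_rLin_twiddle (p : Proc) {n k : ℕ} (hk : k < 2 ^ n) (u v : ℝ) :
    (rLin (p.twiddle n k).re u (p.twiddle n k).im v).arith = p.linCost n k ∧
    (rLin (p.twiddle n k).im u (p.twiddle n k).re v).arith = p.linCost n k := by
  classical
  by_cases h0 : k = 0
  · subst h0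
    have : p.linCost n 0 = 0 := by cases p <;> simp [Proc.linCost]
    rw [twiddle_zero, this, Complex.one_re, Complex.one_im]
    exact ⟨arith_rLin_zero_right _ _ _ isFree_one, arith_rLin_zero_left _ _ _ isFree_one⟩
  · by_cases hp : p = .TW
    · subst hp
      obtain ⟨h1, h2⟩ := cost_pair_of_TW h0 hk
      rw [arith_rLin_of_ne (fun h => h1 (.inl h)) (fun h => h2 (.inl h)),
        arith_rLin_of_ne (fun h => h2 (.inl h)) (fun h => h1 (.inl h))]
      simp only [arith_rSmul_of_not_isFree h1, arith_rSmul_of_not_isFree h2]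
      simp [Proc.linCost, h0]
    · obtain ⟨h1, h2, h3⟩ := cost_pair p hp h0 hk
      have hl : p.linCost n k = (if 2 * k = 2 ^ n then 0 else 1) + 1 := by
        cases p
        · exact absurd rfl hp
        all_goals simp only [Proc.linCost, if_neg h0]; split_ifs <;> rfl
      rw [arith_rLin_of_ne h1 h2, arith_rLin_of_ne h2 h1, hl, ← h3]
      have e (c u : ℝ) : (rSmul c u).arith = if IsFree c then 0 else 1 := by
        split_ifs with h
        exacts [arith_rSmul_of_isFree h u, arith_rSmul_of_not_isFree h u]
      simp only [e, true_and, add_comm]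

/-- The cost of the multiplications of `D, E, F, G` in iteration `k`. -/
def Proc.midCost (k : ℕ) : Proc → ℕ
  | .TWS2 => if k = 0 then 2 else 4
  | _ => 0

/-- The cost of the multiplications of the outputs in iteration `k`. -/
def Proc.endCost (k : ℕ) : Proc → ℕ
  | .TWS4 => if k = 0 then 6 else 8
  | _ => 0

theorem not_isFree_div {a b : ℝ} (ha : 0 < a) (hb : 0 < b) (h : a ≠ b) : ¬ IsFree (a / b) := by
  have hpos : 0 < a / b := div_pos ha hb
  rintro (h' | h' | h')
  · exact hpos.ne' h'
  · exact h ((div_eq_one_iff_eq hb.ne').1 h')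
  · linarith

theorem arith_scaleMid (p : Proc) {n k : ℕ} (hk : k < 2 ^ n) (x y : ℝ × ℝ) :
    (p.scaleMid (scale (n + 2) k / scale (n + 3) k) x).arith +
      (p.scaleMid (scale (n + 2) k / scale (n + 3) (k + 2 ^ n)) y).arith = p.midCost k := by
  cases p
  case TWS2 =>
    simp only [Proc.scaleMid, Proc.midCost]
    by_cases h0 : k = 0
    · subst h0
      rw [if_pos rfl, scale_zero_right, scale_zero_right, div_one,
        arith_cSmul_of_isFree isFree_one, arith_cSmul_of_not_isFree]
      rw [zero_add]
      exact not_isFree_div one_pos (scale_pos _ _) (scale_half_lt_one n).ne'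
    · have h1 : ¬ 2 ^ n ∣ k := Nat.not_dvd_of_pos_of_lt (Nat.pos_of_ne_zero h0) hk
      rw [if_neg h0, arith_cSmul_of_not_isFree, arith_cSmul_of_not_isFree]
      · refine not_isFree_div (scale_pos _ _) (scale_pos _ _) ?_
        -- Shifting the numerator by its period gives both scale factors the same index `k + 2 ^ n`.
        rw [← scale_add_pow]
        exact scale_ne_scale_succ (by rwa [Nat.dvd_add_left dvd_rfl])
      · exact not_isFree_div (scale_pos _ _) (scale_pos _ _) (scale_ne_scale_succ h1)
  all_goals rfl

theorem amp_lt_one {n k : ℕ} (h0 : k ≠ 0) (hk : k < 2 ^ n) : amp (angle (n + 2) k) < 1 := by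
  obtain ⟨hpos, hlt, -, -⟩ := angle_mem h0 hk
  have hpi := Real.pi_pos
  have h1 := Real.sin_sq_add_cos_sq (angle (n + 2) k)
  have hc : 0 < Real.cos (angle (n + 2) k) :=
    Real.cos_pos_of_mem_Ioo ⟨by linarith, by linarith⟩
  have hs : 0 < Real.sin (angle (n + 2) k) := Real.sin_pos_of_pos_of_lt_pi hpos (by linarith)
  rw [amp, abs_of_pos hc, abs_of_pos hs]
  exact max_lt (by nlinarith) (by nlinarith)

/-- No field theory is needed here: the two scale factors are two levels apart, so they differ by a
single factor `amp`, which is below 1. -/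
theorem scale_ne_scale_add_four {n k j : ℕ} (h : k + j * 2 ^ n ≠ 0) (hk : k < 2 ^ n) (hj : j < 4) :
    scale (n + 2) k ≠ scale (n + 4) (k + j * 2 ^ n) := by
  have hlt : k + j * 2 ^ n < 2 ^ (n + 2) := by
    rw [pow_add]
    have := Nat.mul_le_mul_right (2 ^ n) (Nat.le_of_lt_succ hj)
    omega
  have h1 := amp_lt_one h hlt
  rw [scale_add_two (n + 2), scale_shift]
  have := scale_pos (n + 2) k
  exact (mul_lt_of_lt_one_right this h1).ne'

theorem arith_scaleEnd (p : Proc) {n k : ℕ} (hk : k < 2 ^ n) (x : Fin 4 → ℝ × ℝ) :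
    (∑ j : Fin 4, (p.scaleEnd (scale (n + 2) k / scale (n + 4) (k + j * 2 ^ n)) (x j)).arith) =
      p.endCost k := by
  cases p
  case TWS4 =>
    simp only [Proc.scaleEnd, Proc.endCost]
    have key (j : Fin 4) (x : ℝ × ℝ) (h : k + (j : ℕ) * 2 ^ n ≠ 0) :
        (cSmul (scale (n + 2) k / scale (n + 4) (k + j * 2 ^ n)) x).arith = 2 :=
      arith_cSmul_of_not_isFree (not_isFree_div (scale_pos _ _) (scale_pos _ _)
        (scale_ne_scale_add_four h hk j.2)) x
    have hp : 0 < 2 ^ n := by positivity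
    rw [Fin.sum_univ_four, key 1 _ (by simp), key 2 _ (by simp), key 3 _ (by simp)]
    by_cases h0 : k = 0
    · subst h0
      have : scale (n + 2) 0 / scale (n + 4) (0 + ((0 : Fin 4) : ℕ) * 2 ^ n) = 1 := by
        simp [scale_zero_right]
      rw [this, arith_cSmul_of_isFree isFree_one, if_pos rfl]
    · rw [key 0 _ (by simpa using h0), if_neg h0]
  all_goals simp [Proc.scaleEnd, Proc.endCost, isCost_arith.ret]

theorem arith_loopBody (p : Proc) {n k : ℕ} (hk : k < 2 ^ n) (a z b c : ℝ × ℝ) :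
    (loopBody p n k a z b c).arith = 4 * p.linCost n k + p.midCost k + p.endCost k + 8 := by
  simp only [loopBody, isCost_arith.bind, isCost_arith.forEach, arith_scaleEnd p hk,
    arith_rSmul_of_isFree isFree_neg_one, (arith_rLin_twiddle p hk _ _).1,
    (arith_rLin_twiddle p hk _ _).2, arith_cAdd, arith_cSub,
    ← arith_scaleMid p hk ((rLin (p.twiddle n k).re b.1 (p.twiddle n k).im
      (rSmul (-1) c.2).eval).eval, (rLin (p.twiddle n k).re b.2 (p.twiddle n k).im c.1).eval)
      ((rLin (p.twiddle n k).im b.1 (p.twiddle n k).re c.2).eval,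
        (rLin (p.twiddle n k).im b.2 (p.twiddle n k).re (rSmul (-1) c.1).eval).eval)]
  ring

/-- The total cost of the loop. -/
def Proc.loopCost (n : ℕ) (p : Proc) : ℕ :=
  ∑ k ∈ Finset.range (2 ^ n), (4 * p.linCost n k + p.midCost k + p.endCost k + 8)

/-- The number of additions, subtractions and multiplications of a twiddle procedure. -/
def twCost : ℕ → Proc → ℕ
  | 0, _ => 0
  | 1, .TWS4 => 6
  | 1, _ => 4
  | n + 2, p => twCost (n + 1) p.even + 2 * twCost n .TWS + p.loopCost n

theorem arith_tw : ∀ (n : ℕ) (p : Proc) (x : CVec ℝ n), (tw n p x).arith = twCost n p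
  | 0, p, x => rfl
  | 1, p, x => by
    have h : ¬ IsFree (1 / scale 3 1) :=
      not_isFree_div one_pos (scale_pos _ _) (scale_half_lt_one 0).ne'
    cases p
    case TWS4 =>
      simp only [tw, isCost_arith.bind, arith_cAdd, arith_cSub, Proc.scaleEnd,
        arith_cSmul_of_not_isFree h, pure_eq_ret, isCost_arith.ret, twCost]
    all_goals rfl
  | n + 2, p, x => by
    simp only [tw, isCost_arith.bind, isCost_arith.forEach, arith_tw (n + 1), arith_tw n,
      pure_eq_ret, isCost_arith.ret, arith_loopBody p (Fin.is_lt _), twCost, Proc.loopCost]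
    rw [Finset.sum_range]
    ring

theorem halves_rSmul (c u : ℝ) : (rSmul c u).halves = 0 := rfl

theorem halves_rLin (r u q v : ℝ) : (rLin r u q v).halves = 0 := by
  rw [rLin]; split_ifs <;> rfl

theorem shifts_rSmul (c u : ℝ) : (rSmul c u).shifts = 0 := rfl

theorem shifts_rLin (r u q v : ℝ) : (rLin r u q v).shifts = 0 := by
  rw [rLin]; split_ifs <;> rfl

theorem halves_loopBody (p : Proc) (n k : ℕ) (a z b c : ℝ × ℝ) :
    (loopBody p n k a z b c).halves = 0 := by
  simp only [loopBody, isCost_halves.bind, isCost_halves.forEach, halves_rLin, halves_cAdd,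
    halves_cSub]
  cases p <;> simp [Proc.scaleMid, Proc.scaleEnd, halves_cSmul, halves_rSmul, isCost_halves.ret]

theorem shifts_loopBody (p : Proc) (n k : ℕ) (a z b c : ℝ × ℝ) :
    (loopBody p n k a z b c).shifts = 0 := by
  simp only [loopBody, isCost_shifts.bind, isCost_shifts.forEach, shifts_rLin, shifts_cAdd,
    shifts_cSub]
  cases p <;> simp [Proc.scaleMid, Proc.scaleEnd, shifts_cSmul, shifts_rSmul, isCost_shifts.ret]

theorem halves_tw : ∀ (n : ℕ) (p : Proc) (x : CVec ℝ n), (tw n p x).halves = 0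
  | 0, p, x => rfl
  | 1, p, x => by cases p <;> rfl
  | n + 2, p, x => by
    simp [tw, isCost_halves.bind, isCost_halves.forEach, halves_tw (n + 1), halves_tw n,
      isCost_halves.ret, halves_loopBody]

theorem shifts_tw : ∀ (n : ℕ) (p : Proc) (x : CVec ℝ n), (tw n p x).shifts = 0
  | 0, p, x => rfl
  | 1, p, x => by cases p <;> rfl
  | n + 2, p, x => by
    simp [tw, isCost_shifts.bind, isCost_shifts.forEach, shifts_tw (n + 1), shifts_tw n,
      isCost_shifts.ret, shifts_loopBody]

/-! ### Closed forms -/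

theorem sum_range_ite_zero (n : ℕ) (a b : ℝ) :
    ∑ k ∈ Finset.range (2 ^ n), (if k = 0 then a else b) = 2 ^ n * b + (a - b) := by
  have h (k : ℕ) : (if k = 0 then a else b) = b + if k = 0 then a - b else 0 := by
    split_ifs <;> ring
  simp only [h, Finset.sum_add_distrib, Finset.sum_ite_eq', Finset.sum_const, Finset.card_range,
    Finset.mem_range, nsmul_eq_mul]
  simp

theorem loopCost_TW (n : ℕ) : (Proc.TW.loopCost n : ℝ) = 20 * 2 ^ n - 12 := by
  simp only [Proc.loopCost, Proc.linCost, Proc.midCost, Proc.endCost, Nat.cast_sum, Nat.cast_add,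
    Nat.cast_mul, Nat.cast_ite, Finset.sum_add_distrib, ← Finset.mul_sum, sum_range_ite_zero]
  simp
  ring

/-- The cheap index `k = N/8` exists only for `N ≥ 8`, hence the shift to `n + 1`;
`loopCost_TWS_zero` covers `N = 4`. -/
theorem sum_linCost_TWS (n : ℕ) :
    ∑ k ∈ Finset.range (2 ^ (n + 1)), (Proc.TWS.linCost (n + 1) k : ℝ) = 2 * 2 ^ (n + 1) - 3 := by
  have h (k : ℕ) : (Proc.TWS.linCost (n + 1) k : ℝ) =
      (if k = 0 then 0 else 2) - if k = 2 ^ n then 1 else 0 := by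
    have h2 : 2 * k = 2 ^ (n + 1) ↔ k = 2 ^ n := by rw [pow_succ']; omega
    have hp : 2 ^ n ≠ 0 := by positivity
    simp only [Proc.linCost, h2]
    split_ifs with h0 h1 <;> simp_all
    norm_num
  simp only [h, Finset.sum_sub_distrib, sum_range_ite_zero, Finset.sum_ite_eq', Finset.mem_range]
  rw [if_pos (by rw [pow_succ]; have : 0 < 2 ^ n := by positivity
                 omega)]
  ring

theorem loopCost_TWS (n : ℕ) : (Proc.TWS.loopCost (n + 1) : ℝ) = 16 * 2 ^ (n + 1) - 12 := by
  simp only [Proc.loopCost, Proc.midCost, Proc.endCost, Nat.cast_sum, Nat.cast_add,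
    Nat.cast_mul, Finset.sum_add_distrib, ← Finset.mul_sum, sum_linCost_TWS]
  simp
  ring

theorem loopCost_TWS2 (n : ℕ) :
    (Proc.TWS2.loopCost n : ℝ) = Proc.TWS.loopCost n + (4 * 2 ^ n - 2) := by
  simp only [Proc.loopCost, Proc.midCost, Proc.endCost, Proc.linCost, Nat.cast_sum, Nat.cast_add,
    Nat.cast_mul, Nat.cast_ite, Finset.sum_add_distrib, ← Finset.mul_sum, sum_range_ite_zero]
  simp
  ring

theorem loopCost_TWS4 (n : ℕ) :
    (Proc.TWS4.loopCost n : ℝ) = Proc.TWS.loopCost n + (8 * 2 ^ n - 2) := by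
  simp only [Proc.loopCost, Proc.midCost, Proc.endCost, Proc.linCost, Nat.cast_sum, Nat.cast_add,
    Nat.cast_mul, Nat.cast_ite, Finset.sum_add_distrib, ← Finset.mul_sum, sum_range_ite_zero]
  simp
  ring

theorem loopCost_TWS_zero : Proc.TWS.loopCost 0 = 8 := by
  simp [Proc.loopCost, Proc.linCost, Proc.midCost, Proc.endCost]

/-- The three recurrences are solved together. The equation `x_n = x_{n-1} + 2x_{n-2}` has roots 2
and -1, and the alternation between `TWS2` and `TWS4` resonates with -1, which explains the terms
`n(-1)^n`. The formulas fail at length 1, so lengths 2 and 4 are both base cases. -/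
theorem twCost_scaled : ∀ n : ℕ,
    (twCost (n + 1) .TWS : ℝ) = 28 / 9 * (n + 1) * 2 ^ (n + 1) - 130 / 27 * 2 ^ (n + 1)
      - 2 / 9 * (n + 1) * (-1) ^ (n + 1) - 5 / 27 * (-1) ^ (n + 1) + 7 ∧
    (twCost (n + 1) .TWS2 : ℝ) = 28 / 9 * (n + 1) * 2 ^ (n + 1) - 94 / 27 * 2 ^ (n + 1)
      - 2 / 9 * (n + 1) * (-1) ^ (n + 1) + 13 / 27 * (-1) ^ (n + 1) + 5 ∧
    (twCost (n + 1) .TWS4 : ℝ) = 28 / 9 * (n + 1) * 2 ^ (n + 1) - 76 / 27 * 2 ^ (n + 1)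
      - 2 / 9 * (n + 1) * (-1) ^ (n + 1) - 5 / 27 * (-1) ^ (n + 1) + 5
  | 0 => by norm_num [twCost]
  | 1 => by
    simp only [twCost, Proc.even, Nat.cast_add, Nat.cast_mul, loopCost_TWS2, loopCost_TWS4,
      loopCost_TWS_zero]
    norm_num
  | n + 2 => by
    obtain ⟨-, h2, h4⟩ := twCost_scaled (n + 1)
    obtain ⟨h, -, -⟩ := twCost_scaled n
    push_cast at h h2 h4
    have e (p : Proc) : twCost (n + 2 + 1) p =
        twCost (n + 1 + 1) p.even + 2 * twCost (n + 1) .TWS + p.loopCost (n + 1) := twCost.eq_4 _ _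
    simp only [e, Nat.cast_add, Nat.cast_mul, Proc.even, loopCost_TWS2, loopCost_TWS4,
      loopCost_TWS, h, h2, h4]
    push_cast
    refine ⟨?_, ?_, ?_⟩ <;> ring

theorem twCost_TW : ∀ n : ℕ,
    (twCost (n + 2) .TW : ℝ) = 28 / 9 * (n + 2) * 2 ^ (n + 2) - 112 / 27 * 2 ^ (n + 2)
      - 2 / 9 * (n + 2) * (-1) ^ (n + 2) + 4 / 27 * (-1) ^ (n + 2) + 2 * (n + 2)
  | 0 => by
    simp only [twCost, Proc.even, Nat.cast_add, Nat.cast_mul, loopCost_TW]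
    norm_num
  | n + 1 => by
    have h := twCost_TW n
    rw [twCost.eq_4]
    simp only [Proc.even, Nat.cast_add, Nat.cast_mul, loopCost_TW, h, (twCost_scaled n).1]
    push_cast
    ring

theorem neg_one_pow_bounds (n : ℕ) : (-1 : ℝ) ≤ (-1) ^ n ∧ (-1 : ℝ) ^ n ≤ 1 := by
  rcases neg_one_pow_eq_or ℝ n with h | h <;> rw [h] <;> norm_num

theorem twCost_TW_bounds (n : ℕ) :
    28 / 9 * n * 2 ^ n - 112 / 27 * 2 ^ n - 1 ≤ (twCost n .TW : ℝ) ∧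
    (twCost n .TW : ℝ) ≤ 28 / 9 * n * 2 ^ n - 112 / 27 * 2 ^ n + 20 / 9 * n + 10 := by
  match n with
  | 0 => norm_num [twCost]
  | 1 => norm_num [twCost]
  | n + 2 =>
    rw [twCost_TW]
    push_cast
    have hn : (0 : ℝ) ≤ n := n.cast_nonneg
    rcases neg_one_pow_eq_or ℝ (n + 2) with h | h <;> rw [h] <;> constructor <;> linarith

/-! ### Costs of `H'` -/

/-- The sum of `M log M` over the lengths `M` of the arrays of the partition. -/
def logSum (n : ℕ) : ℕ := ((partition n).map fun s => 2 ^ s.1 * s.1).sum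

/-- The sum of `M ⌊log M / 3⌋` over the lengths `M` of the arrays of the partition. -/
def thirdSum (n : ℕ) : ℕ := ((partition n).map fun s => 2 ^ s.1 * (s.1 / 3)).sum

theorem logSum_add_two (n : ℕ) :
    logSum (n + 2) = logSum (n + 1) + (2 * logSum n + 2 * 2 ^ n) := by
  have h (s : Σ m : ℕ, Fin (2 ^ m) → ℕ) :
      2 ^ (s.1 + 1) * (s.1 + 1) = 2 * (2 ^ s.1 * s.1) + 2 * 2 ^ s.1 := by ring
  simp only [logSum, partition, List.map_append, List.map_map, Function.comp_def, List.sum_append,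
    h, List.sum_map_add, List.sum_map_mul_left, sum_partition]

theorem logSum_eq : ∀ n : ℕ,
    (logSum n : ℝ) = n * 2 ^ n / 3 - 2 / 9 * 2 ^ n + 2 / 9 * (-1) ^ n
  | 0 => by norm_num [logSum, partition]
  | 1 => by norm_num [logSum, partition]
  | n + 2 => by
    rw [logSum_add_two]
    push_cast
    rw [logSum_eq n, logSum_eq (n + 1)]
    push_cast
    ring

theorem thirdSum_le (n : ℕ) : 3 * thirdSum n ≤ logSum n := by
  rw [thirdSum, logSum, ← List.sum_map_mul_left]
  refine List.sum_le_sum fun s _ => ?_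
  rw [mul_left_comm]
  exact Nat.mul_le_mul_left _ (Nat.mul_div_le _ _)

/-- Rounding `log M / 3` down loses at most `2M` per array after multiplication by 3, and the
lengths sum to `N`. -/
theorem le_thirdSum (n : ℕ) : logSum n ≤ 3 * thirdSum n + 2 * 2 ^ n := by
  rw [thirdSum, logSum, ← sum_partition n, ← List.sum_map_mul_left, ← List.sum_map_mul_left,
    ← List.sum_map_add]
  refine List.sum_le_sum fun s _ => ?_
  rw [mul_left_comm, mul_comm 2, ← mul_add]
  exact Nat.mul_le_mul_left _ (by omega)

theorem IsCost.hPrime {c : ∀ {α : Type}, Comp ℝ α → ℕ} (hc : IsCost @c) (n : ℕ) (x : CVec ℝ n) :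
    c (hPrime n x) = ((partition n).map fun s =>
      c (wht s.1 0 fun j => CVec.get x (splitRadixIndex n (s.2 j)))).sum :=
  hc.foldlM _ _ (fun b a => by simp [hc.bind, hc.ret]) _ _

theorem four_mul_halves_hPrime (n : ℕ) (x : CVec ℝ n) :
    4 * (hPrime n x).halves = thirdSum n := by
  rw [IsCost.hPrime isCost_halves, ← List.sum_map_mul_left, thirdSum]
  simp only [four_mul_halves_wht]

theorem two_mul_arith_hPrime (n : ℕ) (x : CVec ℝ n) :
    2 * (hPrime n x).arith + thirdSum n = 4 * logSum n := by
  rw [IsCost.hPrime isCost_arith, ← List.sum_map_mul_left, thirdSum, logSum,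
    ← List.sum_map_mul_left, ← List.sum_map_add]
  simp only [two_mul_arith_wht, mul_assoc]

theorem partition_ne_nil : ∀ n : ℕ, partition n ≠ []
  | 0 => by simp [partition]
  | 1 => by simp [partition]
  | n + 2 => by simp [partition, partition_ne_nil (n + 1)]

theorem shifts_hPrime_le (n : ℕ) (x : CVec ℝ n) : (hPrime n x).shifts + 2 ≤ 2 * 2 ^ n := by
  have hlen : 1 ≤ (partition n).length := List.length_pos_iff.2 (partition_ne_nil n)
  have h : ((partition n).map fun s =>
      (wht s.1 0 fun j => CVec.get x (splitRadixIndex n (s.2 j))).shifts + 2).sum ≤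
      ((partition n).map fun s => 2 * 2 ^ s.1).sum :=
    List.sum_le_sum fun s _ => shifts_wht_zero_le _ _
  rw [List.sum_map_add, List.sum_map_mul_left, sum_partition, ← IsCost.hPrime isCost_shifts] at h
  simp at h
  omega

/-! ### Costs of the algorithm -/

theorem arith_whufftRun (n : ℕ) (x : Fin (2 ^ n) → ℂ) :
    2 * (whufftRun n x).arith + thirdSum n = 2 * twCost n .TW + 4 * logSum n := by
  rw [whufftRun, whufft, isCost_arith.bind, arith_tw, ← two_mul_arith_hPrime n]
  ring

theorem halves_whufftRun (n : ℕ) (x : Fin (2 ^ n) → ℂ) :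
    4 * (whufftRun n x).halves = thirdSum n := by
  rw [whufftRun, whufft, isCost_halves.bind, halves_tw, ← four_mul_halves_hPrime n, add_zero]

theorem shifts_whufftRun_le (n : ℕ) (x : Fin (2 ^ n) → ℂ) :
    (whufftRun n x).shifts + 2 ≤ 2 * 2 ^ n := by
  rw [whufftRun, whufft, isCost_shifts.bind, shifts_tw, add_zero]
  exact shifts_hPrime_le n _

/-- Absorbs the term `20n/9` of `twCost_TW_bounds`. The bounds give linear coefficient `-260/108`,
which leaves `37/108` below the claimed `-223/108`, while `20/9 · 1/8 = 30/108`. -/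
theorem eight_mul_le_two_pow_add (n : ℕ) : 8 * n ≤ 2 ^ n + 16 := by
  induction n with
  | zero => norm_num
  | succ n ih =>
    rcases lt_or_ge n 3 with h | h
    · interval_cases n <;> norm_num
    · have : 2 ^ 3 ≤ 2 ^ n := Nat.pow_le_pow_right two_pos h
      rw [pow_succ]
      omega

theorem logb_two_pow (n : ℕ) : Real.logb 2 (2 ^ n) = n := by
  rw [Real.logb_pow, Real.logb_self_eq_one one_lt_two, mul_one]

theorem const_isLittleO_rpow (c : ℝ) {a : ℝ} (ha : 0 < a) :
    (fun _ : ℕ => c) =o[atTop] fun N : ℕ => (N : ℝ) ^ a :=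
  isLittleO_const_left.2 <| .inr <| tendsto_norm_atTop_atTop.comp <|
    (tendsto_rpow_atTop ha).comp tendsto_natCast_atTop_atTop

end Whufft

end

theorem theorem2 :
    -- correctness, for every `N = 2 ^ n`
    (∀ (n : ℕ) (x : Fin (2 ^ n) → ℂ),
      Whufft.whufftOutput n x = Whufft.dftMatrix (2 ^ n) *ᵥ x) ∧
    -- total number of real operations, with an `o(N ^ 0.8)` error term
    (∃ err : ℕ → ℝ, err =o[atTop] (fun N : ℕ => (N : ℝ) ^ (0.8 : ℝ)) ∧
      ∀ (n : ℕ) (x : Fin (2 ^ n) → ℂ),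
        ((Whufft.whufftRun n x).total : ℝ) ≤
          15 / 4 * 2 ^ n * Real.logb 2 (2 ^ n) - 223 / 108 * 2 ^ n + err (2 ^ n)) ∧
    -- total number of real operations, up to `O(N)`
    (∃ C : ℝ, ∀ (n : ℕ) (x : Fin (2 ^ n) → ℂ),
      |((Whufft.whufftRun n x).total : ℝ) - 15 / 4 * 2 ^ n * Real.logb 2 (2 ^ n)| ≤ C * 2 ^ n) ∧
    -- additions and multiplications
    (∃ C : ℝ, ∀ (n : ℕ) (x : Fin (2 ^ n) → ℂ),
      |(((Whufft.whufftRun n x).adds + (Whufft.whufftRun n x).muls : ℕ) : ℝ)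
        - 67 / 18 * 2 ^ n * Real.logb 2 (2 ^ n)| ≤ C * 2 ^ n) ∧
    -- divide-by-two operations
    (∀ (n : ℕ) (x : Fin (2 ^ n) → ℂ),
      ((Whufft.whufftRun n x).halves : ℝ) ≤ 1 / 36 * 2 ^ n * Real.logb 2 (2 ^ n)) ∧
    -- multiply-by-a-power-of-two operations
    (∀ (n : ℕ) (x : Fin (2 ^ n) → ℂ),
      ((Whufft.whufftRun n x).shifts : ℝ) ≤ 2 * 2 ^ n - 2) := by
  -- With the twiddle cost `T`, the sum `L` of `M log M` and the sum `Q` of `M⌊log M / 3⌋`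
  -- abstracted to reals, every count is bounded by linear arithmetic in `n * 2 ^ n`, `2 ^ n` and
  -- `n`.
  have facts (n : ℕ) (x : Fin (2 ^ n) → ℂ) : ∃ T L Q : ℝ,
      2 * ((Whufft.whufftRun n x).arith : ℝ) + Q = 2 * T + 4 * L ∧
      4 * ((Whufft.whufftRun n x).halves : ℝ) = Q ∧
      ((Whufft.whufftRun n x).shifts : ℝ) + 2 ≤ 2 * 2 ^ n ∧
      (0 : ℝ) ≤ (Whufft.whufftRun n x).shifts ∧
      (28 / 9 * n * 2 ^ n - 112 / 27 * 2 ^ n - 1 ≤ T ∧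
        T ≤ 28 / 9 * n * 2 ^ n - 112 / 27 * 2 ^ n + 20 / 9 * n + 10) ∧
      L ≤ n * 2 ^ n / 3 - 2 / 9 * 2 ^ n + 2 / 9 ∧ n * 2 ^ n / 3 - 2 / 9 * 2 ^ n - 2 / 9 ≤ L ∧
      3 * Q ≤ L ∧ L ≤ 3 * Q + 2 * 2 ^ n ∧ 8 * (n : ℝ) ≤ 2 ^ n + 16 ∧ (1 : ℝ) ≤ 2 ^ n := by
    have he := Whufft.neg_one_pow_bounds n
    refine ⟨Whufft.twCost n .TW, Whufft.logSum n, Whufft.thirdSum n, ?_, ?_, ?_,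
      Nat.cast_nonneg _, Whufft.twCost_TW_bounds n, ?_, ?_, ?_, ?_, ?_, one_le_pow₀ one_le_two⟩
    · exact_mod_cast Whufft.arith_whufftRun n x
    · exact_mod_cast Whufft.halves_whufftRun n x
    · exact_mod_cast Whufft.shifts_whufftRun_le n x
    · rw [Whufft.logSum_eq]; linarith
    · rw [Whufft.logSum_eq]; linarith
    · exact_mod_cast Whufft.thirdSum_le n
    · exact_mod_cast Whufft.le_thirdSum n
    · exact_mod_cast Whufft.eight_mul_le_two_pow_add n
  -- the linear term has enough slack for a bounded error
  refine ⟨Whufft.whufftOutput_eq,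
    ⟨fun _ => 20, Whufft.const_isLittleO_rpow 20 (by norm_num), fun n x => ?_⟩,
    ⟨30, fun n x => ?_⟩, ⟨30, fun n x => ?_⟩, fun n x => ?_, fun n x => ?_⟩ <;>
    obtain ⟨T, L, Q, h1, h2, h3, h4, ⟨h5, h6⟩, h7, h8, h9, h10, h11, h12⟩ := facts n x
  · rw [Whufft.logb_two_pow, Whufft.Comp.total_eq]
    push_cast
    linarith
  · rw [Whufft.logb_two_pow, Whufft.Comp.total_eq, abs_le]
    push_cast
    constructor <;> linarith
  · rw [Whufft.logb_two_pow, abs_le]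
    change _ ≤ ((Whufft.whufftRun n x).arith : ℝ) - _ ∧ ((Whufft.whufftRun n x).arith : ℝ) - _ ≤ _
    constructor <;> linarith
  · rw [Whufft.logb_two_pow]
    linarith
  · linarith
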